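/- Let $\lambda>0$, $\alpha>2$, $\rho,\rho_0,R_0,\theta>0$ and let $1\le M\le N_{\mathrm R}-1$ be integers. Interferers are located at the points $x_1,x_2,\dots$ of a stationary Poisson point process of density $\lambda$ in $\mathbb R^2$; write $X_i=\|x_i\|$. A receiver at the origin with $N_{\mathrm R}$ antennas has a desired transmitter at distance $R_0$ with channel vector $\mathbf h_0$, and uses the partial zero-forcing combining vector $$\mathbf v=\frac{(\mathbf I-\mathbf H\mathbf H^{\sharp})\mathbf h_0}{\|(\mathbf I-\mathbf H\mathbf H^{\sharp})\mathbf h_0\|},$$ where $\mathbf H\in\mathbb C^{N_{\mathrm R}\times M}$ has as columns the channel vectors of $M$ interferers to be cancelled and $\mathbf H^{\sharp}$ is its pseudoinverse. Let $\mathbf h_i$, $i\ge1$, be the channel vector of the node at $x_i$ when that node is not cancelled. The vector $\mathbf h_0$, the columns of $\mathbf H$ and the vectors $\mathbf h_i$ ($i\ge 1$) are independent, $\mathcal{CN}(0,\mathbf I)$-distributed, and independent of the point process. Put $S_0=|\mathbf v^{\mathrm H}\mathbf h_0|^2$ and $S_i=|\mathbf v^{\mathrm H}\mathbf h_i|^2$.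 Let $$d_M=(\pi\lambda)^{-1/2}\,\frac{\Gamma(M+\frac12)}{\Gamma(M)},$$ which is the mean distance from the origin to the $M$-th nearest point of the process. Suppose that exactly the interferers within distance $d_M$ are cancelled, while $M$ degrees of freedom are spent on cancellation: the approximate interference, signal-to-interference ratio and success probability are $$\widetilde I(M)=\rho\sum_{i:\,X_i>d_M}X_i^{-\alpha}S_i,\qquad \widetilde{\mathsf{SIR}}(M)=\frac{\rho_0R_0^{-\alpha}S_0}{\widetilde I(M)},\qquad \widetilde{\mathsf P}_{\mathrm{suc}}(\theta,M)=\Pr\big[\widetilde{\mathsf{SIR}}(M)>\theta\big].$$ Then $\widetilde I(M)<\infty$ almost surely, its Laplace transform is, for all $s\ge0$, $$\mathbb E\big[e^{-s\widetilde I(M)}\big]=\mathcal L_{\widetilde I(M)}(s):=\exp\big(-2\pi\lambda\,\Upsilon(s,M)\big),\qquad \Upsilon(s,M)=\frac{s\rho\, d_M^{2-\alpha}}{\alpha-2}\;{}_2F_1\Big(1,\,1-\tfrac2\alpha;\,2-\tfrac2\alpha;\,-s\rho\, d_M^{-\alpha}\Big),$$ where ${}_2F_1$ is the Gauss hypergeometric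 function (the Gauss series, continued analytically to $(-\infty,1)$); the function $\mathcal L_{\widetilde I(M)}$ is smooth on $(0,\infty)$; and $$\widetilde{\mathsf P}_{\mathrm{suc}}(\theta,M)=\sum_{n=0}^{N_{\mathrm R}-M-1}\left[\frac{(-s)^n}{n!}\,\frac{\mathrm d^n}{\mathrm ds^n}\,\mathcal L_{\widetilde I(M)}(s)\right]_{s=\theta\rho_0^{-1}R_0^{\alpha}}.$$ -/

import Mathlib

open MeasureTheory ProbabilityTheory Set
open scoped ENNReal

noncomputable section

namespace PZF

/-! ### The Gauss hypergeometric function on `(-∞, 1)` -/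

/-- `F` is a real-analytic function on `(-∞, 1)` that is given by the Gauss series
`∑ (a)ₙ (b)ₙ / (c)ₙ zⁿ / n!` on its interval of convergence `(-1, 1)`. -/
def IsHypContinuation (a b c : ℝ) (F : ℝ → ℝ) : Prop :=
  AnalyticOnNhd ℝ F (Iio 1) ∧ EqOn F (ordinaryHypergeometric a b c) (Ioo (-1) 1)

open Classical in
/-- The Gauss hypergeometric function `₂F₁(a, b; c; z)` for real `z < 1`: the Gauss series
(Mathlib's `ordinaryHypergeometric`, which is meaningful for `|z| < 1` only), continued
analytically to `(-∞, 1)`. -/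
def hyp2F1 (a b c z : ℝ) : ℝ :=
  if h : ∃ F : ℝ → ℝ, IsHypContinuation a b c F then h.choose z
  else ordinaryHypergeometric a b c z

/-- The analytic continuation is unique, so `hyp2F1` does not depend on any choice. -/
theorem hyp2F1_eq_of_isHypContinuation {a b c : ℝ} {F : ℝ → ℝ} (hF : IsHypContinuation a b c F)
    {z : ℝ} (hz : z < 1) : hyp2F1 a b c z = F z := by
  have h : ∃ F : ℝ → ℝ, IsHypContinuation a b c F := ⟨F, hF⟩
  have hc := h.choose_spec
  have hev : h.choose =ᶠ[nhds 0] F := by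
    filter_upwards [Ioo_mem_nhds (show (-1 : ℝ) < 0 by norm_num) (show (0 : ℝ) < 1 by norm_num)]
      with x hx
    rw [hc.2 hx, hF.2 hx]
  rw [hyp2F1, dif_pos h]
  exact hc.1.eqOn_of_preconnected_of_eventuallyEq hF.1 isPreconnected_Iio
    (show (0 : ℝ) ∈ Iio 1 by norm_num) hev hz

/-- On `(-1, 1)` the function `hyp2F1` is the sum of the Gauss series. -/
theorem hyp2F1_eq_series {a b c z : ℝ} (hz : z ∈ Ioo (-1 : ℝ) 1) :
    hyp2F1 a b c z = ordinaryHypergeometric a b c z := by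
  rw [hyp2F1]
  split_ifs with h
  · exact h.choose_spec.2 hz
  · rfl

/-! ### Poisson point processes -/

/-- The Euclidean plane. -/
abbrev Plane : Type := EuclideanSpace ℝ (Fin 2)

variable {Ω : Type*} [MeasurableSpace Ω]

/-- The number of points of the point process `{x₀, x₁, …}` in the set `A`. -/
def count (x : ℕ → Ω → Plane) (A : Set Plane) (ω : Ω) : ℕ∞ :=
  Set.encard {i : ℕ | x i ω ∈ A}

/-- The random points `x₀, x₁, …` form a stationary Poisson point process of density `lam` in the
plane: the number of points in a set of finite area is Poisson with mean `lam` times the area, and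
the numbers of points in disjoint sets are independent. -/
structure IsPoissonProcess (P : Measure Ω) (lam : ℝ) (x : ℕ → Ω → Plane) : Prop where
  measurable : ∀ i, Measurable (x i)
  law : ∀ A : Set Plane, MeasurableSet A → volume A ≠ ∞ → ∀ k : ℕ,
    P {ω | count x A ω = k} =
      ENNReal.ofReal (Real.exp (-(lam * volume.real A)) * (lam * volume.real A) ^ k / k.factorial)
  indep : ∀ (n : ℕ) (A : Fin n → Set Plane), (∀ k, MeasurableSet (A k)) →
    Pairwise (fun k l => Disjoint (A k) (A l)) → iIndepFun (fun k => count x (A k)) P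

/-- The distance from the origin to the `M`-th nearest point of the process (`M ≥ 1`). -/
def nthDist (x : ℕ → Ω → Plane) (M : ℕ) (ω : Ω) : ℝ :=
  sInf {r : ℝ | 0 ≤ r ∧ (M : ℕ∞) ≤ count x (Metric.closedBall 0 r) ω}

/-! ### Rayleigh fading and the partial zero-forcing receiver -/

/-- The law `𝒞𝒩(0, 1)`: real and imaginary parts are independent `𝒩(0, 1/2)`. -/
def complexNormal : Measure ℂ :=
  ((gaussianReal 0 (1 / 2)).prod (gaussianReal 0 (1 / 2))).map
    (fun p : ℝ × ℝ => (⟨p.1, p.2⟩ : ℂ))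

/-- The law `𝒞𝒩(0, I)` on `ℂᴺ`: independent `𝒞𝒩(0, 1)` coordinates. -/
def complexNormalVec (N : ℕ) : Measure (EuclideanSpace ℂ (Fin N)) :=
  (Measure.pi (fun _ : Fin N => complexNormal)).map (WithLp.toLp 2)

/-- The family of all channel vectors: `h₀` of the associated transmitter, `H k` (`k < M`) of the
`M` interferers that the combining vector is designed against, and `h i` of the node at `x i`, if
that node is not cancelled. -/
def channels {N M : ℕ} (h₀ : Ω → EuclideanSpace ℂ (Fin N))
    (H : Fin M → Ω → EuclideanSpace ℂ (Fin N)) (h : ℕ → Ω → EuclideanSpace ℂ (Fin N)) :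
    Unit ⊕ (Fin M ⊕ ℕ) → Ω → EuclideanSpace ℂ (Fin N) :=
  Sum.elim (fun _ => h₀) (Sum.elim H h)

/-- The network: the interferers form a Poisson point process of density `lam`; all channel vectors
are `𝒞𝒩(0, I)`; they are independent of each other and of the positions of the nodes. -/
structure IsNetwork {N M : ℕ} (P : Measure Ω) (lam : ℝ) (x : ℕ → Ω → Plane)
    (h₀ : Ω → EuclideanSpace ℂ (Fin N)) (H : Fin M → Ω → EuclideanSpace ℂ (Fin N))
    (h : ℕ → Ω → EuclideanSpace ℂ (Fin N)) : Prop where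
  poisson : IsPoissonProcess P lam x
  law : ∀ j, HasLaw (channels h₀ H h j) (complexNormalVec N) P
  indep : iIndepFun (channels h₀ H h) P
  indep_points : IndepFun (fun ω i => x i ω) (fun ω j => channels h₀ H h j ω) P

/-- The combining vector `v = (I - H H♯) h₀ / ‖(I - H H♯) h₀‖`, where `I - H H♯` (with `H♯` the
pseudoinverse) is the orthogonal projection onto the orthogonal complement of the columns of `H`. -/
def combiner {N M : ℕ} (h₀ : Ω → EuclideanSpace ℂ (Fin N))
    (H : Fin M → Ω → EuclideanSpace ℂ (Fin N)) (ω : Ω) : EuclideanSpace ℂ (Fin N) :=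
  let p := (Submodule.span ℂ (range fun k => H k ω))ᗮ.starProjection (h₀ ω)
  ((‖p‖⁻¹ : ℝ) : ℂ) • p

/-- The fading power `S = |vᴴ g|²` after combining, for the channel vector `g`. -/
def fading {N M : ℕ} (h₀ : Ω → EuclideanSpace ℂ (Fin N))
    (H : Fin M → Ω → EuclideanSpace ℂ (Fin N)) (g : Ω → EuclideanSpace ℂ (Fin N)) (ω : Ω) : ℝ :=
  ‖inner ℂ (combiner h₀ H ω) (g ω)‖ ^ 2

/-- The mean distance `d_M = (πλ)^{-1/2} Γ(M + 1/2) / Γ(M)`. -/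
def meanDist (lam : ℝ) (M : ℕ) : ℝ :=
  (Real.pi * lam) ^ (-(1 / 2) : ℝ) * Real.Gamma (M + 1 / 2) / Real.Gamma M

open Classical in
/-- The approximate interference `ρ ∑_{i : Xᵢ > d_M} Xᵢ^{-α} Sᵢ`, where `Xᵢ = ‖xᵢ‖`; a sum of
nonnegative terms, with values in `[0, ∞]`. -/
def interference {N M : ℕ} (lam α ρ : ℝ) (x : ℕ → Ω → Plane)
    (h₀ : Ω → EuclideanSpace ℂ (Fin N)) (H : Fin M → Ω → EuclideanSpace ℂ (Fin N))
    (h : ℕ → Ω → EuclideanSpace ℂ (Fin N)) (ω : Ω) : ℝ≥0∞ :=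
  ∑' i : ℕ, if meanDist lam M < ‖x i ω‖ then
    ENNReal.ofReal (ρ * (‖x i ω‖ ^ (-α) * fading h₀ H (h i) ω)) else 0

/-- The approximate signal-to-interference ratio. -/
def sir {N M : ℕ} (lam α ρ ρ₀ R₀ : ℝ) (x : ℕ → Ω → Plane)
    (h₀ : Ω → EuclideanSpace ℂ (Fin N)) (H : Fin M → Ω → EuclideanSpace ℂ (Fin N))
    (h : ℕ → Ω → EuclideanSpace ℂ (Fin N)) (ω : Ω) : ℝ≥0∞ :=
  ENNReal.ofReal (ρ₀ * R₀ ^ (-α) * fading h₀ H h₀ ω) / interference lam α ρ x h₀ H h ω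

/-- The approximate success probability: the probability that the approximate signal-to-interference
ratio exceeds the threshold `θ`. -/
def successProb {N M : ℕ} (P : Measure Ω) (lam α ρ ρ₀ R₀ θ : ℝ) (x : ℕ → Ω → Plane)
    (h₀ : Ω → EuclideanSpace ℂ (Fin N)) (H : Fin M → Ω → EuclideanSpace ℂ (Fin N))
    (h : ℕ → Ω → EuclideanSpace ℂ (Fin N)) : ℝ :=
  P.real {ω | ENNReal.ofReal θ < sir lam α ρ ρ₀ R₀ x h₀ H h ω}

/-- `Υ(s, M) = s ρ d_M^{2-α} / (α - 2) · ₂F₁(1, 1 - 2/α; 2 - 2/α; -s ρ d_M^{-α})`. -/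
def upsilon (lam α ρ : ℝ) (M : ℕ) (s : ℝ) : ℝ :=
  s * ρ * meanDist lam M ^ (2 - α) / (α - 2) *
    hyp2F1 1 (1 - 2 / α) (2 - 2 / α) (-(s * ρ * meanDist lam M ^ (-α)))

/-- The closed form `exp(-2πλ Υ(s, M))`. -/
def laplaceClosedForm (lam α ρ : ℝ) (M : ℕ) (s : ℝ) : ℝ :=
  Real.exp (-(2 * Real.pi * lam * upsilon lam α ρ M s))

end PZF

end

open PZF

/-!
The interference depends on the points and on the fading powers `Sᵢ = |vᴴhᵢ|²`, the desired power
`S₀ = |vᴴh₀|²` on the vectors that determine `v`. The proof rests on three facts.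

*Fading.* The law `𝒞𝒩(0, I)` is unitarily invariant (`map_complexNormalVec`, by characteristic
functions). Hence the energy of such a vector in an `m`-dimensional subspace is a sum of `m`
independent unit exponential variables (`measure_lt_normSq_starProjection`), with the Erlang tail
`∑_{n < m} e^{-t} tⁿ / n!`. In particular a proper subspace is a null set, so the vectors to be
cancelled are almost surely linearly independent, and `S₀`, the squared distance of `h₀` from their
span, has the Erlang law of shape `N - M`. Given `h₀` and `H`, the vector `v` is a fixed unit vector,
so the `Sᵢ` are independent unit exponential variables; this conditional law does not involve `v`,
and therefore the points, the pair `(H, h₀)` and the sequence `(Sᵢ)` are independent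
(`IsNetwork.map_points_designVectors_fading`). Measurability of `v` comes from the Gram–Schmidt
process.

*Points.* Simple functions and monotone approximation give Campbell's formula and the Laplace
functional `E exp(-∑ g(xᵢ)) = exp(-λ ∫ (1 - e^{-g}))` (`IsPoissonProcess.integral_exp_neg_tsum`).
Campbell's formula shows that the interference is finite. Averaging `e^{-sI}` over the fading gives
`∏ (1 + s a(xᵢ))⁻¹` with the path gain `a`, so its mean is the Laplace functional at
`g = log (1 + s a)`. In polar coordinates the exponent is Euler's integral for the hypergeometric
function, which is the analytic continuation of the Gauss series because it can be expanded in a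
power series about every `z₀ < 1` (`isHypContinuation_eulerIntegral`). The mean of the `M`-th
nearest distance is the integral of the Poisson probabilities of fewer than `M` points in a disc.

*Success.* By independence the success probability is the mean of the Erlang tail at `s I`, that is
`∑ sⁿ / n! E[Iⁿ e^{-sI}]`, and `E[Iⁿ e^{-sI}]` is `(-1)ⁿ` times the `n`-th derivative of the Laplace
transform (`integral_erlangTail_eq`), which is analytic for `s > 0`.
-/

namespace PZF

/-! ### Euler's integral and the hypergeometric function -/

/-- Euler's integral for `₂F₁(1, b; b + 1; z)`, convergent for every real `z < 1`. -/
noncomputable def eulerIntegral (b z : ℝ) : ℝ :=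
  ∫ t in Ioo (0 : ℝ) 1, b * t ^ (b - 1) * (1 - z * t)⁻¹

lemma one_sub_mul_pos {z t : ℝ} (hz : z < 1) (ht : t ∈ Ioo (0 : ℝ) 1) : 0 < 1 - z * t := by
  nlinarith [ht.1, ht.2, mul_pos ht.1 (sub_pos.2 hz)]

/-- Expanding the kernel of Euler's integral in a geometric series about any `z₀ < 1` gives a power
series for the integral with radius of convergence at least `1 - z₀`. -/
lemma hasSum_eulerIntegral {b z₀ z : ℝ} (hb : 0 < b) (hz₀ : z₀ < 1) (hz : |z - z₀| < 1 - z₀) :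
    HasSum (fun n : ℕ => ∫ t in Ioo (0 : ℝ) 1,
        b * t ^ (b - 1) * ((z - z₀) ^ n * (t ^ n * ((1 - z₀ * t)⁻¹) ^ (n + 1))))
      (eulerIntegral b z) := by
  have hz1 : z < 1 := by have := (abs_lt.1 hz).2; linarith
  have h0 : 0 < 1 - z₀ := sub_pos.2 hz₀
  set q := |z - z₀| / (1 - z₀) with hq
  have hq0 : 0 ≤ q := by positivity
  have hq1 : q < 1 := (div_lt_one h0).2 hz
  set K := max 1 (1 - z₀)⁻¹ with hK
  have hint : IntegrableOn (fun t : ℝ => t ^ (b - 1)) (Ioo 0 1) := by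
    have := (intervalIntegral.intervalIntegrable_rpow' (a := 0) (b := 1)
      (show -1 < b - 1 by linarith)).1
    exact this.mono_set Ioo_subset_Ioc_self
  have hKt : ∀ t ∈ Ioo (0 : ℝ) 1, (1 - z₀ * t)⁻¹ ≤ K := by
    intro t ht
    rcases le_total 0 z₀ with h | h
    · refine le_trans ?_ (le_max_right _ _)
      exact inv_anti₀ h0 (by nlinarith [ht.1, ht.2])
    · refine le_trans ?_ (le_max_left _ _)
      exact inv_le_one_of_one_le₀ (by nlinarith [ht.1, ht.2])
  have hratio : ∀ t ∈ Ioo (0 : ℝ) 1, |(z - z₀) * (t * (1 - z₀ * t)⁻¹)| ≤ q := by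
    intro t ht
    have hp := one_sub_mul_pos hz₀ ht
    rw [abs_mul, abs_of_nonneg (mul_nonneg ht.1.le (inv_nonneg.2 hp.le)), hq, div_eq_mul_inv]
    gcongr
    rw [← div_eq_mul_inv, div_le_iff₀ hp, inv_mul_eq_div, le_div_iff₀ h0]
    nlinarith [ht.1, ht.2]
  unfold eulerIntegral
  refine hasSum_integral_of_dominated_convergence
    (fun n t => (b * K) * t ^ (b - 1) * q ^ n) ?_ ?_ ?_ ?_ ?_
  · intro n
    exact Measurable.aestronglyMeasurable (by fun_prop)
  · intro n
    filter_upwards [self_mem_ae_restrict measurableSet_Ioo] with t ht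
    have hp := one_sub_mul_pos hz₀ ht
    have : b * t ^ (b - 1) * ((z - z₀) ^ n * (t ^ n * ((1 - z₀ * t)⁻¹) ^ (n + 1)))
        = (b * (1 - z₀ * t)⁻¹) * t ^ (b - 1) * ((z - z₀) * (t * (1 - z₀ * t)⁻¹)) ^ n := by
      rw [mul_pow, mul_pow]; ring
    rw [this, norm_mul, norm_pow, Real.norm_eq_abs, Real.norm_eq_abs, abs_of_nonneg
      (mul_nonneg (mul_nonneg hb.le (inv_nonneg.2 hp.le)) (Real.rpow_nonneg ht.1.le _))]
    have h1 := hKt t ht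
    have h2 := hratio t ht
    have h3 := Real.rpow_nonneg ht.1.le (b - 1)
    gcongr
  · filter_upwards with t
    exact (summable_geometric_of_lt_one hq0 hq1).mul_left _
  · simp_rw [tsum_mul_left]
    exact (hint.const_mul _).mul_const _
  · filter_upwards [self_mem_ae_restrict measurableSet_Ioo] with t ht
    have hp := one_sub_mul_pos hz₀ ht
    have hp1 := one_sub_mul_pos hz1 ht
    have hg := hasSum_geometric_of_abs_lt_one ((hratio t ht).trans_lt hq1)
    have hg' := hg.mul_left (b * t ^ (b - 1) * (1 - z₀ * t)⁻¹)
    convert! hg' using 1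
    · funext n
      rw [mul_pow, mul_pow]; ring
    · have : 1 - (z - z₀) * (t * (1 - z₀ * t)⁻¹) = (1 - z * t) * (1 - z₀ * t)⁻¹ := by
        field_simp
        ring
      rw [this, mul_inv, inv_inv]
      have e : (1 - z₀ * t)⁻¹ * (1 - z₀ * t) = 1 := inv_mul_cancel₀ hp.ne'
      linear_combination -(b * t ^ (b - 1) * (1 - z * t)⁻¹) * e

lemma analyticAt_eulerIntegral {b z₀ : ℝ} (hb : 0 < b) (hz₀ : z₀ < 1) :
    AnalyticAt ℝ (eulerIntegral b) z₀ := by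
  refine ⟨FormalMultilinearSeries.ofScalars ℝ (fun n => ∫ t in Ioo (0 : ℝ) 1,
    b * t ^ (b - 1) * (t ^ n * ((1 - z₀ * t)⁻¹) ^ (n + 1))), ?_⟩
  rw [hasFPowerSeriesAt_iff']
  filter_upwards [Metric.ball_mem_nhds z₀ (sub_pos.2 hz₀)] with z hz
  rw [Metric.mem_ball, Real.dist_eq] at hz
  convert! hasSum_eulerIntegral hb hz₀ hz using 2 with n
  rw [FormalMultilinearSeries.coeff_ofScalars, smul_eq_mul, ← integral_const_mul]
  congr 1
  funext t
  ring

lemma ascPochhammer_eval_one_eq_factorial (n : ℕ) :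
    (ascPochhammer ℝ n).eval 1 = n.factorial := by
  exact_mod_cast ascPochhammer_eval_one ℝ n

lemma ascPochhammer_eval_mul_add (b : ℝ) (n : ℕ) :
    (ascPochhammer ℝ n).eval (b + 1) * b = (ascPochhammer ℝ n).eval b * (b + n) := by
  rw [← ascPochhammer_succ_eval, ascPochhammer_succ_left, Polynomial.eval_mul,
    Polynomial.eval_X, Polynomial.eval_comp]
  simp [mul_comm]

lemma eulerIntegral_eq_ordinaryHypergeometric {b z : ℝ} (hb : 0 < b) (hz : z ∈ Ioo (-1 : ℝ) 1) :
    eulerIntegral b z = ordinaryHypergeometric 1 b (b + 1) z := by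
  have h := hasSum_eulerIntegral (z₀ := 0) (z := z) hb one_pos
    (by rw [sub_zero, sub_zero]; exact abs_lt.2 hz)
  rw [ordinaryHypergeometric_eq_tsum, ← h.tsum_eq]
  refine tsum_congr fun n => ?_
  have hbn : 0 < b + n := by positivity
  have h1 : ∀ t ∈ Ioo (0 : ℝ) 1, b * t ^ (b - 1) * ((z - 0) ^ n *
      (t ^ n * ((1 - 0 * t)⁻¹) ^ (n + 1))) = (b * z ^ n) * t ^ (b - 1 + n) := by
    intro t ht
    rw [Real.rpow_add ht.1, Real.rpow_natCast]
    simp only [sub_zero, zero_mul, inv_one, one_pow, mul_one]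
    ring
  rw [setIntegral_congr_fun measurableSet_Ioo h1, integral_const_mul,
    ← integral_Ioc_eq_integral_Ioo, ← intervalIntegral.integral_of_le zero_le_one,
    integral_rpow (Or.inl (by linarith)), Real.one_rpow, Real.zero_rpow (by linarith)]
  have hpos : 0 < (ascPochhammer ℝ n).eval (b + 1) := ascPochhammer_pos n _ (by linarith)
  have hrel := ascPochhammer_eval_mul_add b n
  rw [ascPochhammer_eval_one_eq_factorial, inv_mul_cancel₀ (by positivity), one_mul, smul_eq_mul]
  have h2 : b - 1 + n + 1 = b + n := by ring
  rw [h2, sub_zero, ← div_eq_mul_inv, mul_one_div, div_eq_iff hbn.ne', div_mul_eq_mul_div,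
    div_mul_eq_mul_div, eq_div_iff hpos.ne']
  linear_combination z ^ n * hrel

lemma isHypContinuation_eulerIntegral {b : ℝ} (hb : 0 < b) :
    IsHypContinuation 1 b (b + 1) (eulerIntegral b) :=
  ⟨fun _ hz => analyticAt_eulerIntegral hb hz,
    fun _ hz => eulerIntegral_eq_ordinaryHypergeometric hb hz⟩

lemma meanDist_pos {lam : ℝ} (hlam : 0 < lam) {M : ℕ} (hM : 1 ≤ M) : 0 < meanDist lam M := by
  have : (0 : ℝ) < M := by exact_mod_cast hM
  unfold meanDist
  have h1 := Real.Gamma_pos_of_pos this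
  have h2 := Real.Gamma_pos_of_pos (show (0 : ℝ) < M + 1 / 2 by linarith)
  have := Real.pi_pos
  positivity

/-! ### Radial integrals in the plane -/

/-- The substitution `r = d t^{-1/α}` turns a radial integral over `(d, ∞)` into Euler's
integral. -/
lemma integral_Ioi_eq_eulerIntegral {α d a : ℝ} (hα : 2 < α) (hd : 0 < d) :
    ∫ r in Ioi d, r * (a * r ^ (-α) / (1 + a * r ^ (-α))) =
      a * d ^ (2 - α) / (α - 2) * eulerIntegral (1 - 2 / α) (-(a * d ^ (-α))) := by
  have hα0 : 0 < α := by linarith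
  set k : ℝ → ℝ := (Ioi d).indicator fun r => r * (a * r ^ (-α) / (1 + a * r ^ (-α))) with hk
  have h1 : ∫ r in Ioi d, r * (a * r ^ (-α) / (1 + a * r ^ (-α))) = ∫ r in Ioi (0 : ℝ), k r := by
    rw [hk, setIntegral_indicator measurableSet_Ioi, Ioi_inter_Ioi, max_eq_right hd.le]
  have h2 : ∫ r in Ioi (0 : ℝ), k r = d * ∫ r in Ioi (0 : ℝ), k (d * r) := by
    have := integral_comp_mul_left_Ioi k 0 hd
    rw [this, mul_zero, smul_eq_mul, ← mul_assoc, mul_inv_cancel₀ hd.ne', one_mul]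
  have hp : -α⁻¹ ≠ 0 := by simp [hα0.ne']
  rw [h1, h2, ← integral_comp_rpow_Ioi (fun r => k (d * r)) hp, eulerIntegral,
    ← integral_const_mul, ← integral_const_mul, ← integral_indicator measurableSet_Ioi,
    ← integral_indicator measurableSet_Ioo]
  congr 1
  funext t
  by_cases ht : 0 < t
  swap
  · rw [indicator_of_notMem (by simpa using ht), indicator_of_notMem (fun h => ht h.1)]
  rw [indicator_of_mem (by simpa using ht)]
  have hmem : d * t ^ (-α⁻¹) ∈ Ioi d ↔ t < 1 := by
    rw [mem_Ioi, lt_mul_iff_one_lt_right hd]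
    constructor
    · intro h
      by_contra hc
      exact absurd h (not_lt.2 (Real.rpow_le_one_of_one_le_of_nonpos (not_lt.1 hc)
        (by simpa using hα0.le)))
    · intro h
      exact Real.one_lt_rpow_of_pos_of_lt_one_of_neg ht h (by simpa using hα0)
  by_cases ht1 : t < 1
  swap
  · rw [indicator_of_notMem (fun h => ht1 h.2), hk,
      indicator_of_notMem (fun h => ht1 (hmem.1 h)), smul_zero, mul_zero]
  rw [indicator_of_mem (show t ∈ Ioo (0 : ℝ) 1 from ⟨ht, ht1⟩), hk, indicator_of_mem (hmem.2 ht1)]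
  have e1 : (d * t ^ (-α⁻¹)) ^ (-α) = d ^ (-α) * t := by
    rw [Real.mul_rpow hd.le (by positivity), ← Real.rpow_mul ht.le]
    simp [hα0.ne']
  have e2 : d ^ (2 - α) = d * d * d ^ (-α) := by
    rw [sub_eq_add_neg, Real.rpow_add hd]
    norm_num [sq]
  have e3 : t ^ (1 - 2 / α - 1) * t ^ (1 : ℝ) = t ^ (-α⁻¹ - 1) * t ^ (-α⁻¹) * t ^ (2 : ℝ) := by
    rw [← Real.rpow_add ht, ← Real.rpow_add ht, ← Real.rpow_add ht]
    congr 1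
    field_simp
    ring
  have e4 : t ^ (1 - 2 / α - 1) = t ^ (-α⁻¹ - 1) * t ^ (-α⁻¹) * t := by
    rw [Real.rpow_one, Real.rpow_two, sq, ← mul_assoc] at e3
    exact mul_right_cancel₀ ht.ne' e3
  have hα2 : α - 2 ≠ 0 := by linarith
  rw [e1, e2, e4, abs_neg, abs_of_pos (inv_pos.2 hα0)]
  simp only [smul_eq_mul, neg_mul, sub_neg_eq_add]
  rw [div_eq_mul_inv (a * (d ^ (-α) * t)), ← mul_assoc a (d ^ (-α)) t]
  field_simp

lemma upsilon_eq_integral {lam α ρ : ℝ} {M : ℕ} (hlam : 0 < lam) (hα : 2 < α) (hρ : 0 < ρ)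
    (hM : 1 ≤ M) {s : ℝ} (hs : 0 ≤ s) :
    upsilon lam α ρ M s = ∫ r in Ioi (meanDist lam M),
      r * (s * ρ * r ^ (-α) / (1 + s * ρ * r ^ (-α))) := by
  have hd := meanDist_pos hlam hM
  have hb : 0 < 1 - 2 / α := by
    rw [sub_pos, div_lt_one (by linarith)]
    exact hα
  have hc : 2 - 2 / α = 1 - 2 / α + 1 := by ring
  rw [integral_Ioi_eq_eulerIntegral hα hd, upsilon, hc,
    hyp2F1_eq_of_isHypContinuation (isHypContinuation_eulerIntegral hb)]
  have : 0 ≤ s * ρ * meanDist lam M ^ (-α) := by positivity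
  linarith

/-- Polar coordinates in the plane. -/
lemma integral_plane_norm (f : ℝ → ℝ) :
    ∫ y : Plane, f ‖y‖ = 2 * Real.pi * ∫ r in Ioi (0 : ℝ), r * f r := by
  rw [integral_fun_norm_addHaar volume f]
  simp [Measure.real, EuclideanSpace.volume_ball_fin_two, Real.pi_pos.le, mul_assoc]

lemma integrable_plane_norm_iff (f : ℝ → ℝ) :
    Integrable (fun y : Plane => f ‖y‖) ↔ IntegrableOn (fun r => r * f r) (Ioi 0) := by
  rw [integrable_fun_norm_addHaar volume]
  simp

/-- The finite sum behind the closed form of the mean distance. -/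
lemma sum_Gamma_half_div_factorial (m : ℕ) :
    ∑ k ∈ Finset.range (m + 1), Real.Gamma (k + 1 / 2) / (2 * k.factorial) =
      Real.Gamma (m + 1 + 1 / 2) / m.factorial := by
  induction m with
  | zero =>
    rw [Finset.sum_range_one]
    have := Real.Gamma_add_one (show (1 / 2 : ℝ) ≠ 0 by norm_num)
    simp only [Nat.cast_zero, zero_add, Nat.factorial_zero, Nat.cast_one]
    rw [add_comm, this]
    ring
  | succ m ih =>
    rw [Finset.sum_range_succ, ih]
    have h1 := Real.Gamma_add_one (show (m + 1 + 1 / 2 : ℝ) ≠ 0 by positivity)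
    push_cast [Nat.factorial_succ]
    rw [show (m : ℝ) + 1 + 1 + 1 / 2 = m + 1 + 1 / 2 + 1 by ring, h1]
    have : (m.factorial : ℝ) ≠ 0 := by positivity
    have : (m + 1 : ℝ) ≠ 0 := by positivity
    field_simp

end PZF

namespace PZF

/-! ### Poisson processes: Campbell's formula and the Laplace functional -/

lemma coe_count {Ω : Type*} (x : ℕ → Ω → Plane) (A : Set Plane) (ω : Ω) :
    (count x A ω : ℝ≥0∞) = ∑' i, A.indicator 1 (x i ω) := by
  rw [count, ← ENNReal.tsum_set_one, tsum_subtype (f := fun _ => (1 : ℝ≥0∞))]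
  rfl

lemma measurable_of_measurable_toENNReal {β : Type*} [MeasurableSpace β] {f : β → ℕ∞}
    (hf : Measurable fun b => (f b : ℝ≥0∞)) : Measurable f := by
  refine measurable_to_countable' fun k => ?_
  have : f ⁻¹' {k} = (fun b => (f b : ℝ≥0∞)) ⁻¹' {(k : ℝ≥0∞)} := by
    ext b
    simp
  rw [this]
  exact hf (measurableSet_singleton _)

variable {Ω : Type*} [MeasurableSpace Ω] {P : Measure Ω} {lam : ℝ} {x : ℕ → Ω → Plane}

lemma IsPoissonProcess.measurable_count (hx : IsPoissonProcess P lam x) {A : Set Plane}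
    (hA : MeasurableSet A) : Measurable (count x A) := by
  refine measurable_of_measurable_toENNReal ?_
  simp_rw [coe_count]
  exact Measurable.tsum fun i => (measurable_one.indicator hA).comp (hx.measurable i)

lemma IsPoissonProcess.count_ne_top [IsProbabilityMeasure P] (hx : IsPoissonProcess P lam x)
    (hlam : 0 < lam) {A : Set Plane} (hA : MeasurableSet A) (hv : volume A ≠ ∞) :
    ∀ᵐ ω ∂P, count x A ω ≠ ⊤ := by
  have hm := hx.measurable_count hA
  have hU : P (⋃ k : ℕ, {ω | count x A ω = k}) = 1 := by
    rw [measure_iUnion]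
    · have hr : 0 ≤ lam * volume.real A := by positivity
      simp_rw [hx.law A hA hv]
      have h := hasSum_one_poissonMeasure (lam * volume.real A).toNNReal
      rw [Real.coe_toNNReal _ hr] at h
      rw [← ENNReal.ofReal_tsum_of_nonneg (fun n => by positivity) h.summable]
      simpa using congrArg ENNReal.ofReal h.tsum_eq
    · intro k l hkl
      refine Set.disjoint_left.2 fun ω h1 h2 => hkl ?_
      exact_mod_cast (h1 : count x A ω = k).symm.trans h2
    · intro k
      exact hm (measurableSet_singleton _)
  have hae : ∀ᵐ ω ∂P, ω ∈ ⋃ k : ℕ, {ω | count x A ω = k} := by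
    rw [← mem_ae_iff_prob_eq_one] at hU
    · exact hU
    · exact MeasurableSet.iUnion fun k => hm (measurableSet_singleton _)
  filter_upwards [hae] with ω hω h
  obtain ⟨k, hk⟩ := mem_iUnion.1 hω
  rw [mem_ofPred_eq, h] at hk
  exact ENat.top_ne_natCast k hk

/-- The number of points in a set of finite area has the Poisson law of Mathlib. -/
lemma IsPoissonProcess.map_count [IsProbabilityMeasure P] (hx : IsPoissonProcess P lam x)
    (hlam : 0 < lam) {A : Set Plane} (hA : MeasurableSet A) (hv : volume A ≠ ∞) :
    P.map (count x A) =
      (poissonMeasure (lam * volume.real A).toNNReal).map (Nat.cast : ℕ → ℕ∞) := by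
  refine Measure.ext_of_singleton fun k => ?_
  rw [Measure.map_apply (hx.measurable_count hA) (measurableSet_singleton _),
    Measure.map_apply (measurable_of_countable _) (measurableSet_singleton _)]
  induction k using ENat.recTopCoe with
  | top =>
    have h1 : (Nat.cast : ℕ → ℕ∞) ⁻¹' {⊤} = ∅ := by ext; simp
    rw [h1, measure_empty]
    have h := ae_iff.1 (hx.count_ne_top hlam hA hv)
    simp only [ne_eq, not_not] at h
    exact h
  | coe k =>
    have h1 : (Nat.cast : ℕ → ℕ∞) ⁻¹' {(k : ℕ∞)} = {k} := by ext; simp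
    rw [h1, poissonMeasure_singleton, Real.coe_toNNReal _ (by positivity)]
    exact hx.law A hA hv k

lemma lintegral_natCast_poissonMeasure (r : NNReal) :
    ∫⁻ n, (n : ℝ≥0∞) ∂poissonMeasure r = r := by
  have h := hasSum_one_poissonMeasure r
  have h1 : ∀ n : ℕ, ENNReal.ofReal (Real.exp (-r) * r ^ (n + 1) / (n + 1).factorial) *
      ((n + 1 : ℕ) : ℝ≥0∞) =
        ENNReal.ofReal r * ENNReal.ofReal (Real.exp (-r) * r ^ n / n.factorial) := by
    intro n
    rw [← ENNReal.ofReal_natCast, ← ENNReal.ofReal_mul (by positivity),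
      ← ENNReal.ofReal_mul (by positivity)]
    congr 1
    rw [Nat.factorial_succ, Nat.cast_mul, pow_succ]
    have h2 : ((n + 1 : ℕ) : ℝ) ≠ 0 := by positivity
    have h3 : (n.factorial : ℝ) ≠ 0 := by positivity
    field_simp
  rw [poissonMeasure, lintegral_sum_measure]
  simp only [lintegral_smul_measure, lintegral_dirac, smul_eq_mul]
  rw [tsum_eq_zero_add' ENNReal.summable, tsum_congr h1, ENNReal.tsum_mul_left,
    ← ENNReal.ofReal_tsum_of_nonneg (fun n => by positivity) h.summable, h.tsum_eq]
  simp

/-- The intensity measure of the process is `lam` times the area. -/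
lemma IsPoissonProcess.sum_map_eq [IsProbabilityMeasure P] (hx : IsPoissonProcess P lam x)
    (hlam : 0 < lam) :
    Measure.sum (fun i => P.map (x i)) = ENNReal.ofReal lam • volume := by
  have hfin : ∀ A : Set Plane, MeasurableSet A → volume A ≠ ∞ →
      Measure.sum (fun i => P.map (x i)) A = (ENNReal.ofReal lam • volume) A := by
    intro A hA hv
    have h1 : Measure.sum (fun i => P.map (x i)) A = ∫⁻ ω, count x A ω ∂P := by
      simp_rw [coe_count]
      have hm : ∀ i, AEMeasurable (fun ω => A.indicator (1 : Plane → ℝ≥0∞) (x i ω)) P :=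
        fun i => ((measurable_one.indicator hA).comp (hx.measurable i)).aemeasurable
      rw [Measure.sum_apply _ hA, lintegral_tsum hm]
      refine tsum_congr fun i => ?_
      rw [← lintegral_map (measurable_one.indicator hA) (hx.measurable i),
        lintegral_indicator_one hA]
    rw [h1, ← lintegral_map (f := fun k : ℕ∞ => (k : ℝ≥0∞)) (measurable_of_countable _)
      (hx.measurable_count hA), hx.map_count hlam hA hv,
      lintegral_map (measurable_of_countable _) (measurable_of_countable _)]
    simp only [ENat.toENNReal_coe]
    rw [lintegral_natCast_poissonMeasure, Measure.smul_apply, smul_eq_mul,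
      ← ENNReal.ofReal_toReal hv, ← ENNReal.ofReal_mul hlam.le]
    rfl
  rw [Measure.ext_iff_of_iUnion_eq_univ (s := fun n : ℕ => Metric.closedBall (0 : Plane) n)
    (Metric.iUnion_closedBall_nat 0)]
  intro n
  ext A hA
  rw [Measure.restrict_apply hA, Measure.restrict_apply hA]
  refine hfin _ (hA.inter Metric.isClosed_closedBall.measurableSet) ?_
  exact ((measure_mono inter_subset_right).trans_lt measure_closedBall_lt_top).ne

/-- Campbell's formula. -/
lemma IsPoissonProcess.lintegral_tsum_eq [IsProbabilityMeasure P] (hx : IsPoissonProcess P lam x)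
    (hlam : 0 < lam) {g : Plane → ℝ≥0∞} (hg : Measurable g) :
    ∫⁻ ω, ∑' i, g (x i ω) ∂P = ENNReal.ofReal lam * ∫⁻ y, g y := by
  have hm : ∀ i, AEMeasurable (fun ω => g (x i ω)) P :=
    fun i => (hg.comp (hx.measurable i)).aemeasurable
  rw [lintegral_tsum hm, ← smul_eq_mul,
    ← lintegral_smul_measure, ← hx.sum_map_eq hlam, lintegral_sum_measure]
  exact tsum_congr fun i => (lintegral_map hg (hx.measurable i)).symm

lemma IsPoissonProcess.tsum_ne_top [IsProbabilityMeasure P] (hx : IsPoissonProcess P lam x)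
    (hlam : 0 < lam) {g : Plane → ℝ≥0∞} (hg : Measurable g) (hfin : ∫⁻ y, g y ≠ ∞) :
    ∀ᵐ ω ∂P, ∑' i, g (x i ω) ≠ ∞ := by
  have hm : Measurable fun ω => ∑' i, g (x i ω) :=
    Measurable.tsum fun i => hg.comp (hx.measurable i)
  have := ae_lt_top (μ := P) hm
    (by rw [hx.lintegral_tsum_eq hlam hg]; exact ENNReal.mul_ne_top ENNReal.ofReal_ne_top hfin)
  filter_upwards [this] with ω h using h.ne

/-- Laplace transform of the number of points in a set. -/
lemma IsPoissonProcess.integral_exp_neg_mul_count [IsProbabilityMeasure P]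
    (hx : IsPoissonProcess P lam x) (hlam : 0 < lam) {A : Set Plane} (hA : MeasurableSet A)
    (c : ℝ≥0∞) (hv : c ≠ 0 → volume A ≠ ∞) :
    ∫ ω, Real.exp (-(c * count x A ω).toReal) ∂P =
      Real.exp (-(lam * (volume.real A * (1 - Real.exp (-c.toReal))))) := by
  rcases eq_or_ne c 0 with rfl | hc
  · simp
  have hv := hv hc
  rw [← integral_map (f := fun k : ℕ∞ => Real.exp (-(c * k).toReal))
    (hx.measurable_count hA).aemeasurable
    (measurable_of_countable _).aestronglyMeasurable, hx.map_count hlam hA hv,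
    integral_map_cast_poissonMeasure, Real.coe_toNNReal _ (by positivity)]
  set m : ℝ := lam * volume.real A with hm
  have h1 : ∀ n : ℕ, (Real.exp (-m) * m ^ n / n.factorial) •
      Real.exp (-(c * ((n : ℕ∞) : ℝ≥0∞)).toReal) =
      Real.exp (-m) * ((m * Real.exp (-c.toReal)) ^ n / n.factorial) := by
    intro n
    rw [ENat.toENNReal_coe, ENNReal.toReal_mul, ENNReal.toReal_natCast, smul_eq_mul,
      mul_pow m (Real.exp _), ← Real.exp_nat_mul]
    rw [show (n : ℝ) * -c.toReal = -(c.toReal * n) by ring]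
    ring
  refine (tsum_congr h1).trans ?_
  rw [tsum_mul_left]
  have h2 : ∑' n : ℕ, (m * Real.exp (-c.toReal)) ^ n / n.factorial =
      Real.exp (m * Real.exp (-c.toReal)) := by
    rw [Real.exp_eq_exp_ℝ, NormedSpace.exp_eq_tsum_div]
  rw [h2, ← Real.exp_add]
  congr 1
  rw [hm]
  ring

/-- A function of a simple function, decomposed over the level sets. -/
lemma simpleFunc_eq_sum_indicator {α β : Type*} [MeasurableSpace α] [AddCommMonoid β]
    (φ : SimpleFunc α ℝ≥0∞) (h : ℝ≥0∞ → β) (y : α) :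
    h (φ y) = ∑ c ∈ φ.range, (φ ⁻¹' {c}).indicator (fun _ => h c) y := by
  classical
  rw [Finset.sum_eq_single (φ y)]
  · simp
  · intro c _ hc
    exact indicator_of_notMem (fun h => hc (by simpa using h.symm)) _
  · intro hc
    exact absurd (φ.mem_range_self y) hc

lemma IsPoissonProcess.integral_exp_neg_tsum_simpleFunc [IsProbabilityMeasure P]
    (hx : IsPoissonProcess P lam x) (hlam : 0 < lam) (φ : SimpleFunc Plane ℝ≥0∞)
    (htop : ∀ y, φ y ≠ ∞) (hfin : ∫⁻ y, φ y ≠ ∞) :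
    ∫ ω, Real.exp (-(∑' i, φ (x i ω)).toReal) ∂P =
      Real.exp (-(lam * ∫ y, (1 - Real.exp (-(φ y).toReal)))) := by
  -- integrability bounds the area of every level set except that of the value `0`
  have hvol : ∀ c : ℝ≥0∞, c ≠ 0 → volume (φ ⁻¹' {c}) ≠ ∞ := by
    intro c hc htp
    have h1 := mul_meas_ge_le_lintegral (μ := (volume : Measure Plane)) φ.measurable c
    have h2 : volume {y | c ≤ φ y} = ∞ := by
      refine top_unique (htp ▸ measure_mono ?_)
      intro y hy
      exact (show φ y = c from hy).ge
    rw [h2, ENNReal.mul_top hc] at h1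
    exact hfin (top_unique h1)
  have hmeas : ∀ c : ℝ≥0∞, MeasurableSet (φ ⁻¹' {c}) := φ.measurableSet_fiber
  have hsum : ∀ ω, ∑' i, φ (x i ω) = ∑ c ∈ φ.range, c * count x (φ ⁻¹' {c}) ω := by
    intro ω
    simp_rw [coe_count, ← ENNReal.tsum_mul_left]
    rw [← Summable.tsum_finsetSum fun c _ => ENNReal.summable]
    refine tsum_congr fun i => ?_
    have := simpleFunc_eq_sum_indicator φ id (x i ω)
    simp only [id] at this
    refine this.trans (Finset.sum_congr rfl fun c _ => ?_)
    by_cases h : x i ω ∈ φ ⁻¹' {c}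
    · rw [indicator_of_mem h, indicator_of_mem h]; simp
    · rw [indicator_of_notMem h, indicator_of_notMem h]; simp
  have hcne : ∀ c ∈ φ.range, c ≠ ∞ := by
    intro c hc
    obtain ⟨y, rfl⟩ := φ.mem_range.1 hc
    exact htop y
  have hterm : ∀ᵐ ω ∂P, ∀ c ∈ φ.range, c * count x (φ ⁻¹' {c}) ω ≠ ∞ := by
    rw [Finset.eventually_all]
    intro c hc
    rcases eq_or_ne c 0 with rfl | hc0
    · simp
    · filter_upwards [hx.count_ne_top hlam (hmeas c) (hvol c hc0)] with ω hω
      exact ENNReal.mul_ne_top (hcne c hc) (by simpa using hω)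
  have hprod : (fun ω => Real.exp (-(∑' i, φ (x i ω)).toReal)) =ᵐ[P]
      ∏ c : φ.range, (fun k : ℕ∞ => Real.exp (-((c : ℝ≥0∞) * k).toReal)) ∘
        count x (φ ⁻¹' {(c : ℝ≥0∞)}) := by
    filter_upwards [hterm] with ω hω
    rw [hsum, ENNReal.toReal_sum hω, ← Finset.sum_neg_distrib, Real.exp_sum, Finset.prod_apply,
      ← Finset.prod_coe_sort]
    rfl
  have hindep : iIndepFun (fun c : φ.range => count x (φ ⁻¹' {(c : ℝ≥0∞)})) P := by
    have e := φ.range.equivFin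
    have h := hx.indep _ (fun k => φ ⁻¹' {((e.symm k : φ.range) : ℝ≥0∞)}) (fun k => hmeas _) (by
      intro k l hkl
      refine Disjoint.preimage _ (Set.disjoint_singleton.2 fun h => hkl ?_)
      exact e.symm.injective (Subtype.ext h))
    have h' := h.precomp e.injective
    refine h'.congr fun c => ?_
    simp
  rw [integral_congr_ae hprod, hindep.integral_prod_comp
    (fun c => (hx.measurable_count (hmeas _)).aemeasurable)
    (fun c => (measurable_of_countable _).aestronglyMeasurable)]
  simp only [Function.comp_apply]
  simp_rw [fun c : φ.range => hx.integral_exp_neg_mul_count hlam (hmeas c) c (hvol c)]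
  rw [← Real.exp_sum, Finset.sum_coe_sort φ.range
    (fun c => -(lam * (volume.real (φ ⁻¹' {c}) * (1 - Real.exp (-c.toReal)))))]
  congr 1
  rw [Finset.sum_neg_distrib, ← Finset.mul_sum]
  congr 2
  simp_rw [simpleFunc_eq_sum_indicator φ (fun c => 1 - Real.exp (-c.toReal))]
  rw [integral_finsetSum]
  · refine Finset.sum_congr rfl fun c _ => ?_
    rw [integral_indicator_const _ (hmeas c), smul_eq_mul]
  · intro c _
    rcases eq_or_ne c 0 with rfl | hc0
    · simp
    · exact (integrable_indicator_iff (hmeas c)).2 (integrableOn_const (hvol c hc0))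

lemma tendsto_tsum_eapprox {α : Type*} [MeasurableSpace α] {g : α → ℝ≥0∞} (hg : Measurable g)
    (y : ℕ → α) :
    Filter.Tendsto (fun n => ∑' i, SimpleFunc.eapprox g n (y i)) Filter.atTop
      (nhds (∑' i, g (y i))) := by
  simp_rw [← lintegral_count]
  refine lintegral_tendsto_of_tendsto_of_monotone
    (fun n => (measurable_of_countable _).aemeasurable) ?_ ?_
  · exact Filter.Eventually.of_forall fun i n m hnm => SimpleFunc.monotone_eapprox g hnm (y i)
  · exact Filter.Eventually.of_forall fun i => SimpleFunc.tendsto_eapprox hg (y i)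

/-- The Laplace functional of a Poisson process. -/
lemma IsPoissonProcess.integral_exp_neg_tsum [IsProbabilityMeasure P]
    (hx : IsPoissonProcess P lam x) (hlam : 0 < lam) {g : Plane → ℝ≥0∞} (hg : Measurable g)
    (htop : ∀ y, g y ≠ ∞) (hfin : ∫⁻ y, g y ≠ ∞) :
    ∫ ω, Real.exp (-(∑' i, g (x i ω)).toReal) ∂P =
      Real.exp (-(lam * ∫ y, (1 - Real.exp (-(g y).toReal)))) := by
  have hle : ∀ n y, SimpleFunc.eapprox g n y ≤ g y := fun n y => by
    rw [← SimpleFunc.iSup_eapprox_apply hg y]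
    exact le_iSup (fun n => SimpleFunc.eapprox g n y) n
  -- pass to the limit along the simple functions increasing to `g`
  have hn : ∀ n, ∫ ω, Real.exp (-(∑' i, SimpleFunc.eapprox g n (x i ω)).toReal) ∂P =
      Real.exp (-(lam * ∫ y, (1 - Real.exp (-(SimpleFunc.eapprox g n y).toReal)))) := fun n =>
    hx.integral_exp_neg_tsum_simpleFunc hlam _ (fun y => (SimpleFunc.eapprox_lt_top g n y).ne)
      (((lintegral_mono (hle n)).trans_lt hfin.lt_top).ne)
  have hL : Filter.Tendsto
      (fun n => ∫ ω, Real.exp (-(∑' i, SimpleFunc.eapprox g n (x i ω)).toReal) ∂P)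
      Filter.atTop (nhds (∫ ω, Real.exp (-(∑' i, g (x i ω)).toReal) ∂P)) := by
    refine tendsto_integral_of_dominated_convergence (fun _ => 1) ?_ (integrable_const _) ?_ ?_
    · intro n
      refine Measurable.aestronglyMeasurable ?_
      have : Measurable fun ω => ∑' i, SimpleFunc.eapprox g n (x i ω) :=
        Measurable.tsum fun i => (SimpleFunc.measurable _).comp (hx.measurable i)
      fun_prop
    · intro n
      filter_upwards with ω
      rw [Real.norm_eq_abs, Real.abs_exp, Real.exp_le_one_iff, neg_nonpos]
      exact ENNReal.toReal_nonneg
    · filter_upwards [hx.tsum_ne_top hlam hg hfin] with ω hω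
      exact (Real.continuous_exp.tendsto _).comp
        (((ENNReal.tendsto_toReal hω).comp (tendsto_tsum_eapprox hg fun i => x i ω)).neg)
  have hR : Filter.Tendsto
      (fun n => ∫ y, (1 - Real.exp (-(SimpleFunc.eapprox g n y).toReal))) Filter.atTop
      (nhds (∫ y, (1 - Real.exp (-(g y).toReal)))) := by
    refine tendsto_integral_of_dominated_convergence (fun y => (g y).toReal) ?_
      (integrable_toReal_of_lintegral_ne_top hg.aemeasurable hfin) ?_ ?_
    · intro n
      refine Measurable.aestronglyMeasurable ?_
      have := (SimpleFunc.eapprox g n).measurable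
      fun_prop
    · intro n
      filter_upwards with y
      have h1 : (SimpleFunc.eapprox g n y).toReal ≤ (g y).toReal :=
        ENNReal.toReal_mono (htop y) (hle n y)
      have h2 := Real.add_one_le_exp (-(SimpleFunc.eapprox g n y).toReal)
      have h3 : Real.exp (-(SimpleFunc.eapprox g n y).toReal) ≤ 1 :=
        Real.exp_le_one_iff.2 (neg_nonpos.2 ENNReal.toReal_nonneg)
      rw [Real.norm_eq_abs, abs_of_nonneg (by linarith)]
      linarith
    · filter_upwards with y
      exact tendsto_const_nhds.sub ((Real.continuous_exp.tendsto _).comp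
        (((ENNReal.tendsto_toReal (htop y)).comp (SimpleFunc.tendsto_eapprox hg y)).neg))
  refine tendsto_nhds_unique hL ?_
  simp_rw [hn]
  exact (Real.continuous_exp.tendsto _).comp ((hR.const_mul lam).neg)

end PZF

namespace PZF

/-! ### The mean distance to the `M`-th nearest point -/

variable {Ω : Type*} [MeasurableSpace Ω] {P : Measure Ω} {lam : ℝ} {x : ℕ → Ω → Plane}

lemma count_mono {Ω : Type*} (x : ℕ → Ω → Plane) (ω : Ω) {A B : Set Plane} (h : A ⊆ B) :
    count x A ω ≤ count x B ω :=
  Set.encard_le_encard fun _ hi => h hi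

/-- The `M`-th nearest distance is the length of the set of radii whose disc contains fewer than
`M` points. -/
lemma volume_count_closedBall_lt {Ω : Type*} (x : ℕ → Ω → Plane) (M : ℕ) (ω : Ω)
    (hne : ∃ r : ℝ, 0 ≤ r ∧ (M : ℕ∞) ≤ count x (Metric.closedBall 0 r) ω) :
    volume {r : ℝ | 0 < r ∧ count x (Metric.closedBall 0 r) ω < M} =
      ENNReal.ofReal (nthDist x M ω) := by
  set S := {r : ℝ | 0 ≤ r ∧ (M : ℕ∞) ≤ count x (Metric.closedBall 0 r) ω} with hS
  have hbdd : BddBelow S := ⟨0, fun r hr => hr.1⟩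
  have hD : nthDist x M ω = sInf S := rfl
  apply le_antisymm
  · have : {r : ℝ | 0 < r ∧ count x (Metric.closedBall 0 r) ω < M} ⊆ Ioc 0 (nthDist x M ω) := by
      rintro r ⟨h0, hr⟩
      refine ⟨h0, ?_⟩
      rw [hD]
      refine le_csInf hne fun t ht => ?_
      by_contra hc
      exact absurd (ht.2.trans (count_mono x ω
        (Metric.closedBall_subset_closedBall (not_le.1 hc).le))) (not_le.2 hr)
    simpa using measure_mono (μ := volume) this
  · have : Ioo 0 (nthDist x M ω) ⊆ {r : ℝ | 0 < r ∧ count x (Metric.closedBall 0 r) ω < M} := by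
      rintro r ⟨h0, hr⟩
      refine ⟨h0, ?_⟩
      by_contra hc
      exact absurd (csInf_le hbdd (show r ∈ S from ⟨h0.le, not_lt.1 hc⟩)) (not_le.2 hr)
    simpa using measure_mono (μ := volume) this

lemma IsPoissonProcess.measurableSet_count_closedBall_lt (hx : IsPoissonProcess P lam x) (M : ℕ) :
    MeasurableSet {p : Ω × ℝ | count x (Metric.closedBall 0 p.2) p.1 < M} := by
  have hm : Measurable fun p : Ω × ℝ => count x (Metric.closedBall 0 p.2) p.1 := by
    refine measurable_of_measurable_toENNReal ?_
    simp_rw [coe_count]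
    refine Measurable.tsum fun i => ?_
    have h1 : MeasurableSet {p : Ω × ℝ | ‖x i p.1‖ ≤ p.2} :=
      measurableSet_le ((hx.measurable i).comp measurable_fst).norm measurable_snd
    have h2 : (fun p : Ω × ℝ => (Metric.closedBall (0 : Plane) p.2).indicator (1 : Plane → ℝ≥0∞)
        (x i p.1)) = {p : Ω × ℝ | ‖x i p.1‖ ≤ p.2}.indicator 1 := by
      funext p
      simp only [indicator, Metric.mem_closedBall, dist_zero_right, mem_ofPred_eq, Pi.one_apply]
    rw [h2]
    exact measurable_one.indicator h1
  exact hm (MeasurableSet.of_discrete (s := Iio (M : ℕ∞)))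

/-- The Poisson tail: the disc of radius `r` has fewer than `M` points. -/
lemma IsPoissonProcess.measure_count_closedBall_lt [IsProbabilityMeasure P]
    (hx : IsPoissonProcess P lam x) (hlam : 0 < lam) (M : ℕ) {r : ℝ} (hr : 0 ≤ r) :
    P {ω | count x (Metric.closedBall 0 r) ω < M} =
      ENNReal.ofReal (∑ k ∈ Finset.range M, Real.exp (-(lam * (Real.pi * r ^ 2))) *
        (lam * (Real.pi * r ^ 2)) ^ k / k.factorial) := by
  have hm := hx.measurable_count (Metric.isClosed_closedBall (x := (0 : Plane)) (ε := r)).measurableSet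
  have hvol : volume.real (Metric.closedBall (0 : Plane) r) = Real.pi * r ^ 2 := by
    rw [Measure.real, EuclideanSpace.volume_closedBall_fin_two, ENNReal.toReal_mul,
      ENNReal.toReal_pow, ENNReal.toReal_ofReal hr, ENNReal.toReal_ofReal Real.pi_pos.le, mul_comm]
  have hset : {ω | count x (Metric.closedBall 0 r) ω < M} =
      ⋃ k ∈ Finset.range M, {ω | count x (Metric.closedBall 0 r) ω = k} := by
    ext ω
    simp only [mem_ofPred_eq, mem_iUnion, Finset.mem_range, exists_prop]
    constructor
    · intro h
      obtain ⟨k, hk⟩ := ENat.ne_top_iff_exists.1 (h.trans_le le_top).ne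
      exact ⟨k, by rw [← hk] at h; exact_mod_cast h, hk.symm⟩
    · rintro ⟨k, hk, h⟩
      rw [h]
      exact_mod_cast hk
  rw [hset, measure_biUnion_finset, ENNReal.ofReal_sum_of_nonneg]
  · refine Finset.sum_congr rfl fun k _ => ?_
    rw [hx.law _ Metric.isClosed_closedBall.measurableSet measure_closedBall_lt_top.ne, hvol]
  · intro k _
    positivity
  · intro k _ l _ hkl
    refine Set.disjoint_left.2 fun ω h1 h2 => hkl ?_
    exact_mod_cast (h1 : count x (Metric.closedBall 0 r) ω = k).symm.trans h2
  · intro k _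
    exact hm (measurableSet_singleton _)

lemma IsPoissonProcess.exists_le_count_closedBall [IsProbabilityMeasure P]
    (hx : IsPoissonProcess P lam x) (hlam : 0 < lam) (M : ℕ) :
    ∀ᵐ ω ∂P, ∃ r : ℝ, 0 ≤ r ∧ (M : ℕ∞) ≤ count x (Metric.closedBall 0 r) ω := by
  rw [ae_iff]
  have hlim : Filter.Tendsto (fun n : ℕ => ENNReal.ofReal (∑ k ∈ Finset.range M,
      Real.exp (-(lam * (Real.pi * (n : ℝ) ^ 2))) * (lam * (Real.pi * (n : ℝ) ^ 2)) ^ k /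
        k.factorial)) Filter.atTop (nhds 0) := by
    rw [← ENNReal.ofReal_zero]
    refine ENNReal.tendsto_ofReal ?_
    rw [← Finset.sum_const_zero (s := Finset.range M)]
    refine tendsto_finsetSum _ fun k _ => ?_
    have h1 : Filter.Tendsto (fun n : ℕ => lam * (Real.pi * (n : ℝ) ^ 2)) Filter.atTop
        Filter.atTop := by
      refine Filter.Tendsto.const_mul_atTop hlam (Filter.Tendsto.const_mul_atTop Real.pi_pos ?_)
      exact (Filter.tendsto_pow_atTop two_ne_zero).comp tendsto_natCast_atTop_atTop
    have h2 := ((Real.tendsto_pow_mul_exp_neg_atTop_nhds_zero k).comp h1).div_const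
      (k.factorial : ℝ)
    rw [zero_div] at h2
    refine h2.congr fun n => ?_
    simp only [Function.comp_apply]
    ring
  refine le_antisymm (ge_of_tendsto' hlim fun n => ?_) zero_le
  rw [← hx.measure_count_closedBall_lt hlam M (Nat.cast_nonneg n)]
  refine measure_mono fun ω hω => ?_
  simp only [mem_ofPred_eq, not_exists, not_and, not_le] at hω ⊢
  exact hω n (Nat.cast_nonneg n)

/-- The Poisson probability of exactly `k` points in the disc of radius `r`, integrated over `r`. -/
lemma integrableOn_poisson_disc {lam : ℝ} (hlam : 0 < lam) (k : ℕ) :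
    IntegrableOn (fun r : ℝ => Real.exp (-(lam * (Real.pi * r ^ 2))) *
      (lam * (Real.pi * r ^ 2)) ^ k / k.factorial) (Ioi 0) ∧
    ∫ r in Ioi (0 : ℝ), Real.exp (-(lam * (Real.pi * r ^ 2))) *
      (lam * (Real.pi * r ^ 2)) ^ k / k.factorial =
      (Real.pi * lam) ^ (-(1 / 2) : ℝ) * (Real.Gamma (k + 1 / 2) / (2 * k.factorial)) := by
  set b := Real.pi * lam with hb
  have hb0 : 0 < b := mul_pos Real.pi_pos hlam
  have hq : (-1 : ℝ) < 2 * k := by have : (0 : ℝ) ≤ k := k.cast_nonneg; linarith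
  have heq : EqOn (fun r : ℝ => Real.exp (-(lam * (Real.pi * r ^ 2))) *
      (lam * (Real.pi * r ^ 2)) ^ k / k.factorial) (fun r : ℝ => (b ^ k / k.factorial) *
        (r ^ (2 * k : ℝ) * Real.exp (-b * r ^ (2 : ℝ)))) (Ioi 0) := by
    intro r hr
    have h1 : r ^ (2 * k : ℝ) = (r ^ 2) ^ k := by
      rw [← pow_mul, ← Real.rpow_natCast]
      norm_num
    simp only [h1, Real.rpow_two]
    have h2 : lam * (Real.pi * r ^ 2) = b * r ^ 2 := by rw [hb]; ring
    rw [h2, mul_pow, neg_mul]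
    ring
  have hint : IntegrableOn (fun r : ℝ => r ^ (2 * k : ℝ) * Real.exp (-b * r ^ (2 : ℝ))) (Ioi 0) :=
    integrableOn_rpow_mul_exp_neg_mul_rpow hq (by norm_num) hb0
  refine ⟨(integrableOn_congr_fun heq measurableSet_Ioi).2 (hint.const_mul _), ?_⟩
  rw [setIntegral_congr_fun measurableSet_Ioi heq, integral_const_mul,
    integral_rpow_mul_exp_neg_mul_rpow (by norm_num) hq hb0]
  have h3 : -(2 * (k : ℝ) + 1) / 2 = -(1 / 2) - k := by ring
  have h4 : (2 * (k : ℝ) + 1) / 2 = k + 1 / 2 := by ring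
  rw [h3, h4, Real.rpow_sub hb0, Real.rpow_natCast]
  field_simp

lemma integral_poisson_disc_sum {lam : ℝ} (hlam : 0 < lam) {M : ℕ} (hM : 1 ≤ M) :
    ∫ r in Ioi (0 : ℝ), ∑ k ∈ Finset.range M, Real.exp (-(lam * (Real.pi * r ^ 2))) *
        (lam * (Real.pi * r ^ 2)) ^ k / k.factorial = meanDist lam M := by
  rw [integral_finsetSum _ fun k _ => (integrableOn_poisson_disc hlam k).1]
  simp_rw [fun k => (integrableOn_poisson_disc hlam k).2]
  obtain ⟨m, rfl⟩ := Nat.exists_eq_add_of_le' hM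
  rw [← Finset.mul_sum, sum_Gamma_half_div_factorial, meanDist]
  push_cast
  rw [Real.Gamma_nat_eq_factorial, mul_div_assoc]

theorem IsPoissonProcess.integrable_nthDist_and_integral [IsProbabilityMeasure P]
    (hx : IsPoissonProcess P lam x) (hlam : 0 < lam) {M : ℕ} (hM : 1 ≤ M) :
    Integrable (nthDist x M) P ∧ ∫ ω, nthDist x M ω ∂P = meanDist lam M := by
  set E := {p : Ω × ℝ | count x (Metric.closedBall 0 p.2) p.1 < M} with hE
  have hEm : MeasurableSet E := hx.measurableSet_count_closedBall_lt M
  set μ : Measure ℝ := volume.restrict (Ioi 0) with hμ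
  have hD0 : ∀ ω, 0 ≤ nthDist x M ω := fun ω => Real.sInf_nonneg fun r hr => hr.1
  have hfib : ∀ᵐ ω ∂P, ENNReal.ofReal (nthDist x M ω) = μ (Prod.mk ω ⁻¹' E) := by
    filter_upwards [hx.exists_le_count_closedBall hlam M] with ω hω
    rw [← volume_count_closedBall_lt x M ω hω, hμ, Measure.restrict_apply' measurableSet_Ioi]
    congr 1
    ext r
    exact and_comm
  have hlint : ∫⁻ ω, ENNReal.ofReal (nthDist x M ω) ∂P = ENNReal.ofReal (meanDist lam M) := by
    rw [lintegral_congr_ae hfib, ← Measure.prod_apply hEm, Measure.prod_apply_symm hEm,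
      ← integral_poisson_disc_sum hlam hM, ofReal_integral_eq_lintegral_ofReal]
    · refine lintegral_congr_ae ?_
      filter_upwards [self_mem_ae_restrict measurableSet_Ioi] with r hr
      exact hx.measure_count_closedBall_lt hlam M (le_of_lt hr)
    · exact integrable_finsetSum _ fun k _ => (integrableOn_poisson_disc hlam k).1
    · filter_upwards with r
      exact Finset.sum_nonneg fun k _ => by positivity
  have hmeas : AEMeasurable (nthDist x M) P := by
    refine ⟨fun ω => (μ (Prod.mk ω ⁻¹' E)).toReal,
      (measurable_measure_prodMk_left hEm).ennreal_toReal, ?_⟩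
    filter_upwards [hfib] with ω hω
    rw [← hω, ENNReal.toReal_ofReal (hD0 ω)]
  have hnn : 0 ≤ᵐ[P] nthDist x M := Filter.Eventually.of_forall hD0
  constructor
  · refine ⟨hmeas.aestronglyMeasurable, ?_⟩
    rw [hasFiniteIntegral_iff_ofReal hnn, hlint]
    exact ENNReal.ofReal_lt_top
  · rw [integral_eq_lintegral_of_nonneg_ae hnn hmeas.aestronglyMeasurable, hlint,
      ENNReal.toReal_ofReal (meanDist_pos hlam hM).le]

end PZF

namespace PZF

/-! ### Exponential and Erlang laws -/

lemma measurable_complex_mk : Measurable fun p : ℝ × ℝ => (⟨p.1, p.2⟩ : ℂ) :=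
  Complex.measurableEquivRealProd.symm.measurable

instance : IsProbabilityMeasure complexNormal :=
  Measure.isProbabilityMeasure_map
    measurable_complex_mk.aemeasurable

instance (N : ℕ) : IsProbabilityMeasure (complexNormalVec N) :=
  Measure.isProbabilityMeasure_map (by fun_prop)

instance : IsProbabilityMeasure (expMeasure 1) := isProbabilityMeasure_expMeasure one_pos

lemma lintegral_expMeasure_one {f : ℝ → ℝ≥0∞} (hf : Measurable f) :
    ∫⁻ u, f u ∂expMeasure 1 = ∫⁻ u in Ioi 0, ENNReal.ofReal (Real.exp (-u)) * f u := by
  rw [expMeasure, gammaMeasure, lintegral_withDensity_eq_lintegral_mul _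
    (show Measurable (gammaPDF 1 1) from (measurable_gammaPDFReal 1 1).ennreal_ofReal) hf, ← lintegral_indicator measurableSet_Ioi]
  refine lintegral_congr_ae ?_
  have h0 : ∀ᵐ u : ℝ, u ≠ 0 := by simp [ae_iff]
  filter_upwards [h0] with u hu
  change exponentialPDF 1 u * f u = _
  rcases lt_or_gt_of_ne hu with h | h
  · rw [exponentialPDF_of_neg h, indicator_of_notMem (by simpa using h.le), zero_mul]
  · rw [exponentialPDF_of_nonneg h.le, indicator_of_mem (mem_Ioi.2 h)]
    simp

lemma lintegral_exp_neg_Ioi (t : ℝ) :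
    ∫⁻ u in Ioi t, ENNReal.ofReal (Real.exp (-u)) = ENNReal.ofReal (Real.exp (-t)) := by
  rw [← integral_exp_neg_Ioi t, ofReal_integral_eq_lintegral_ofReal]
  · exact integrableOn_exp_neg_Ioi t
  · exact Filter.Eventually.of_forall fun u => (Real.exp_pos _).le

/-- The tail of `|Z|²` for `Z ∼ 𝒞𝒩(0, 1)`, in polar coordinates. -/
lemma measure_normSq_complexNormal {t : ℝ} (ht : 0 ≤ t) :
    complexNormal {z | t < ‖z‖ ^ 2} = ENNReal.ofReal (Real.exp (-t)) := by
  have hm : MeasurableSet {z : ℂ | t < ‖z‖ ^ 2} := measurableSet_lt (by fun_prop) (by fun_prop)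
  have hv : (1 / 2 : NNReal) ≠ 0 := by norm_num
  have hpi := Real.pi_pos
  have hdens : ∀ p : ℝ × ℝ, gaussianPDF 0 (1 / 2) p.1 * gaussianPDF 0 (1 / 2) p.2 =
      ENNReal.ofReal (Real.pi⁻¹ * Real.exp (-(p.1 ^ 2 + p.2 ^ 2))) := by
    intro p
    rw [gaussianPDF_def, gaussianPDFReal_def]
    simp only [sub_zero]
    rw [← ENNReal.ofReal_mul (by positivity)]
    congr 1
    have h2 : (2 * Real.pi * ((1 / 2 : NNReal) : ℝ)) = Real.pi := by push_cast; ring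
    have h3 : (2 * ((1 / 2 : NNReal) : ℝ)) = 1 := by push_cast; ring
    rw [h2, h3, div_one, div_one, neg_add, Real.exp_add]
    have h4 : (√Real.pi)⁻¹ * (√Real.pi)⁻¹ = Real.pi⁻¹ := by
      rw [← mul_inv, Real.mul_self_sqrt hpi.le]
    rw [← h4]
    ring
  set S : Set (ℝ × ℝ) := {p | t < p.1 ^ 2 + p.2 ^ 2} with hS
  have hSm : MeasurableSet S := measurableSet_lt (by fun_prop) (by fun_prop)
  have hset : (fun p : ℝ × ℝ => (⟨p.1, p.2⟩ : ℂ)) ⁻¹' {z | t < ‖z‖ ^ 2} = S := by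
    ext p
    change t < ‖(⟨p.1, p.2⟩ : ℂ)‖ ^ 2 ↔ t < p.1 ^ 2 + p.2 ^ 2
    rw [Complex.sq_norm, Complex.normSq_mk, sq, sq]
  rw [complexNormal, Measure.map_apply measurable_complex_mk hm, hset,
    gaussianReal_of_var_ne_zero 0 hv,
    prod_withDensity (measurable_gaussianPDF _ _) (measurable_gaussianPDF _ _),
    withDensity_apply _ hSm]
  simp_rw [hdens]
  rw [← Measure.volume_eq_prod, ← lintegral_indicator hSm, ← lintegral_comp_polarCoord_symm,
    polarCoord_target, Measure.volume_eq_prod, ← Measure.prod_restrict]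
  set g : ℝ → ℝ≥0∞ := (Ioi (√t)).indicator
    (fun r => ENNReal.ofReal (Real.pi⁻¹ * (r * Real.exp (-r ^ 2)))) with hg
  have hgm : Measurable g := Measurable.indicator (by fun_prop) measurableSet_Ioi
  have h1 : ∀ p : ℝ × ℝ, p ∈ Ioi (0 : ℝ) ×ˢ Ioo (-Real.pi) Real.pi → ENNReal.ofReal p.1 •
      S.indicator (fun p => ENNReal.ofReal (Real.pi⁻¹ * Real.exp (-(p.1 ^ 2 + p.2 ^ 2))))
        (polarCoord.symm p) = g p.1 * 1 := by
    intro p hp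
    have hp0 : 0 < p.1 := hp.1
    have h2 : (p.1 * Real.cos p.2) ^ 2 + (p.1 * Real.sin p.2) ^ 2 = p.1 ^ 2 := by
      have := Real.sin_sq_add_cos_sq p.2
      linear_combination p.1 ^ 2 * this
    have h3 : polarCoord.symm p ∈ S ↔ p.1 ∈ Ioi (√t) := by
      rw [polarCoord_symm_apply, hS, mem_ofPred_eq, h2, mem_Ioi, Real.sqrt_lt' hp0]
    by_cases hp1 : p.1 ∈ Ioi (√t)
    · rw [indicator_of_mem (h3.2 hp1), hg, indicator_of_mem hp1, polarCoord_symm_apply]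
      simp only [h2]
      rw [smul_eq_mul, ← ENNReal.ofReal_mul hp0.le, mul_one]
      congr 1
      ring
    · rw [indicator_of_notMem (fun h => hp1 (h3.1 h)), hg, indicator_of_notMem hp1]
      simp
  rw [Measure.prod_restrict, setLIntegral_congr_fun
    (measurableSet_Ioi.prod measurableSet_Ioo) h1, ← Measure.prod_restrict,
    lintegral_prod_mul hgm.aemeasurable aemeasurable_const, hg,
    lintegral_indicator measurableSet_Ioi, Measure.restrict_restrict measurableSet_Ioi,
    inter_eq_left.2 (Ioi_subset_Ioi (Real.sqrt_nonneg t))]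
  have hderiv : ∀ r ∈ Ici (√t), HasDerivAt (fun r : ℝ => -(2 * Real.pi)⁻¹ * Real.exp (-r ^ 2))
      (Real.pi⁻¹ * (r * Real.exp (-r ^ 2))) r := by
    intro r _
    have h5 := (((hasDerivAt_pow 2 r).neg).exp).const_mul (-(2 * Real.pi)⁻¹)
    convert! h5 using 1
    push_cast
    field_simp
    norm_num
  have hnn : ∀ r ∈ Ioi (√t), 0 ≤ Real.pi⁻¹ * (r * Real.exp (-r ^ 2)) := by
    intro r hr
    have : 0 < r := (Real.sqrt_nonneg t).trans_lt hr
    positivity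
  have hlim : Filter.Tendsto (fun r : ℝ => -(2 * Real.pi)⁻¹ * Real.exp (-r ^ 2)) Filter.atTop
      (nhds 0) := by
    have : Filter.Tendsto (fun r : ℝ => Real.exp (-r ^ 2)) Filter.atTop (nhds 0) :=
      Real.tendsto_exp_atBot.comp
        (Filter.tendsto_neg_atTop_atBot.comp (Filter.tendsto_pow_atTop two_ne_zero))
    simpa using this.const_mul (-(2 * Real.pi)⁻¹)
  have hI := integral_Ioi_of_hasDerivAt_of_nonneg' hderiv hnn hlim
  have hII := integrableOn_Ioi_deriv_of_nonneg' hderiv hnn hlim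
  rw [← ofReal_integral_eq_lintegral_ofReal hII
    ((ae_restrict_mem measurableSet_Ioi).mono hnn), hI, lintegral_one,
    Measure.restrict_apply_univ, Real.volume_Ioo, Real.sq_sqrt ht, ← ENNReal.ofReal_mul (by
      have := Real.exp_pos (-t); have : 0 < (2 * Real.pi)⁻¹ := by positivity
      nlinarith)]
  congr 1
  field_simp
  ring

/-- `|Z|²` is exponential with mean one for `Z ∼ 𝒞𝒩(0, 1)`. -/
lemma map_normSq_complexNormal :
    complexNormal.map (fun z => ‖z‖ ^ 2) = expMeasure 1 := by
  have hm : Measurable fun z : ℂ => ‖z‖ ^ 2 := by fun_prop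
  have : IsProbabilityMeasure (complexNormal.map (fun z => ‖z‖ ^ 2)) :=
    Measure.isProbabilityMeasure_map hm.aemeasurable
  refine Measure.eq_of_cdf _ _ ?_
  ext t
  rw [cdf_expMeasure_eq one_pos, cdf_eq_real, one_mul]
  split_ifs with ht
  · have h1 : (Iic t : Set ℝ) = (Ioi t)ᶜ := by simp
    rw [h1, probReal_compl_eq_one_sub measurableSet_Ioi, Measure.real,
      Measure.map_apply hm measurableSet_Ioi]
    change 1 - (complexNormal {z | t < ‖z‖ ^ 2}).toReal = _
    rw [measure_normSq_complexNormal ht, ENNReal.toReal_ofReal (Real.exp_pos _).le]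
  · rw [Measure.real, Measure.map_apply hm measurableSet_Iic]
    have : (fun z : ℂ => ‖z‖ ^ 2) ⁻¹' Iic t = ∅ := by
      ext z
      simp only [mem_preimage, mem_Iic, mem_empty_iff_false, iff_false, not_le]
      exact (not_le.1 ht).trans_le (by positivity)
    rw [this]
    simp

lemma integral_exp_neg_mul_expMeasure {a : ℝ} (ha : 0 ≤ a) :
    ∫ u, Real.exp (-(a * u)) ∂expMeasure 1 = (1 + a)⁻¹ := by
  rw [integral_eq_lintegral_of_nonneg_ae
    (Filter.Eventually.of_forall fun u => (Real.exp_pos _).le)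
    (Measurable.aestronglyMeasurable (by fun_prop)), lintegral_expMeasure_one (by fun_prop)]
  have h1 : ∀ u : ℝ, ENNReal.ofReal (Real.exp (-u)) * ENNReal.ofReal (Real.exp (-(a * u))) =
      ENNReal.ofReal (Real.exp (-(1 + a) * u)) := by
    intro u
    rw [← ENNReal.ofReal_mul (Real.exp_pos _).le, ← Real.exp_add]
    congr 2
    ring
  simp_rw [h1]
  rw [← ofReal_integral_eq_lintegral_ofReal
    (integrableOn_exp_mul_Ioi (show -(1 + a) < 0 by linarith) 0)
    (Filter.Eventually.of_forall fun u => (Real.exp_pos _).le),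
    integral_exp_mul_Ioi (show -(1 + a) < 0 by linarith), ENNReal.toReal_ofReal]
  · rw [mul_zero, Real.exp_zero, neg_div_neg_eq, one_div]
  · rw [mul_zero, Real.exp_zero, neg_div_neg_eq]
    positivity

lemma lintegral_ofReal_expMeasure : ∫⁻ u, ENNReal.ofReal u ∂expMeasure 1 = 1 := by
  rw [lintegral_expMeasure_one (by fun_prop)]
  have h1 : ∀ u ∈ Ioi (0 : ℝ), ENNReal.ofReal (Real.exp (-u)) * ENNReal.ofReal u =
      ENNReal.ofReal (Real.exp (-u) * u ^ ((2 : ℝ) - 1)) := by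
    intro u _
    rw [← ENNReal.ofReal_mul (Real.exp_pos _).le]
    norm_num
  rw [setLIntegral_congr_fun measurableSet_Ioi h1, ← ofReal_integral_eq_lintegral_ofReal
    (Real.GammaIntegral_convergent (by norm_num)), ← Real.Gamma_eq_integral (by norm_num)]
  · simp
  · filter_upwards [ae_restrict_mem measurableSet_Ioi] with u hu
    have : (0 : ℝ) < u := hu
    positivity

/-- The tail `∑_{n < m} e^{-t} tⁿ / n!` of the Gamma law with integer shape `m` and unit rate. -/
noncomputable def erlangTail (m : ℕ) (t : ℝ) : ℝ :=
  ∑ n ∈ Finset.range m, t ^ n / n.factorial * Real.exp (-t)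

lemma erlangTail_nonneg (m : ℕ) {t : ℝ} (ht : 0 ≤ t) : 0 ≤ erlangTail m t :=
  Finset.sum_nonneg fun n _ => by positivity

lemma continuous_erlangTail (m : ℕ) : Continuous (erlangTail m) := by
  unfold erlangTail
  fun_prop

/-- Conditioning on a further exponential summand raises the shape by one. -/
lemma erlangTail_succ (m : ℕ) (t : ℝ) :
    erlangTail (m + 1) t =
      (∫ u in (0 : ℝ)..t, Real.exp (-u) * erlangTail m (t - u)) + Real.exp (-t) := by
  have h1 : ∀ u : ℝ, Real.exp (-u) * erlangTail m (t - u) =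
      ∑ n ∈ Finset.range m, Real.exp (-t) / n.factorial * (t - u) ^ n := by
    intro u
    rw [erlangTail, Finset.mul_sum]
    refine Finset.sum_congr rfl fun n _ => ?_
    have : Real.exp (-t) = Real.exp (-u) * Real.exp (-(t - u)) := by
      rw [← Real.exp_add]; ring_nf
    rw [this]
    ring
  simp_rw [h1]
  rw [intervalIntegral.integral_finsetSum
    fun n _ => Continuous.intervalIntegrable (by fun_prop) _ _]
  simp_rw [intervalIntegral.integral_const_mul]
  have h2 : ∀ n : ℕ, ∫ u in (0 : ℝ)..t, (t - u) ^ n = t ^ (n + 1) / (n + 1) := by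
    intro n
    rw [intervalIntegral.integral_comp_sub_left (fun u => u ^ n), integral_pow]
    simp
  simp_rw [h2]
  rw [erlangTail, Finset.sum_range_succ']
  congr 1
  · refine Finset.sum_congr rfl fun n _ => ?_
    rw [Nat.factorial_succ]
    push_cast
    field_simp
  · simp

/-- A sum of independent unit exponential variables has the Erlang law. -/
lemma measure_lt_sum_of_iIndepFun_exp {Ω ι : Type*} [MeasurableSpace Ω] {μ : Measure Ω}
    [IsProbabilityMeasure μ] {X : ι → Ω → ℝ} (hX : ∀ i, Measurable (X i)) (h0 : ∀ i ω, 0 ≤ X i ω)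
    (hlaw : ∀ i, μ.map (X i) = expMeasure 1) (hind : iIndepFun X μ) (s : Finset ι) {t : ℝ}
    (ht : 0 ≤ t) : μ {ω | t < ∑ i ∈ s, X i ω} = ENNReal.ofReal (erlangTail s.card t) := by
  classical
  induction s using Finset.induction_on generalizing t with
  | empty => simp [erlangTail, ht.not_gt]
  | insert i s hi ih =>
    have hY : Measurable (∑ j ∈ s, X j) := by
      rw [Finset.sum_fn]
      exact Finset.measurable_sum _ fun j _ => hX j
    have hprod := (indepFun_iff_map_prod_eq_prod_map_map (hX i).aemeasurable hY.aemeasurable).1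
      (hind.indepFun_finsetSum_of_notMem hX hi).symm
    have hE : MeasurableSet {p : ℝ × ℝ | t < p.1 + p.2} :=
      measurableSet_lt (by fun_prop) (by fun_prop)
    have : IsProbabilityMeasure (μ.map (∑ j ∈ s, X j)) :=
      Measure.isProbabilityMeasure_map hY.aemeasurable
    have h1 : {ω | t < ∑ j ∈ insert i s, X j ω} =
        (fun ω => (X i ω, (∑ j ∈ s, X j) ω)) ⁻¹' {p : ℝ × ℝ | t < p.1 + p.2} := by
      ext ω
      simp [Finset.sum_insert hi]
    rw [h1, ← Measure.map_apply ((hX i).prodMk hY) hE, hprod, Measure.prod_apply hE, hlaw i,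
      lintegral_expMeasure_one (measurable_measure_prodMk_left hE), Finset.card_insert_of_notMem hi]
    have hsmall : ∀ u ∈ Ioc (0 : ℝ) t, ENNReal.ofReal (Real.exp (-u)) *
        (μ.map (∑ j ∈ s, X j)) (Prod.mk u ⁻¹' {p : ℝ × ℝ | t < p.1 + p.2}) =
        ENNReal.ofReal (Real.exp (-u) * erlangTail s.card (t - u)) := by
      intro u hu
      rw [ENNReal.ofReal_mul (Real.exp_pos _).le, ← ih (sub_nonneg.2 hu.2),
        Measure.map_apply hY (measurable_prodMk_left hE)]
      congr 2
      ext ω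
      simp [sub_lt_iff_lt_add']
    have hlarge : ∀ u ∈ Ioi t, ENNReal.ofReal (Real.exp (-u)) *
        (μ.map (∑ j ∈ s, X j)) (Prod.mk u ⁻¹' {p : ℝ × ℝ | t < p.1 + p.2}) =
        ENNReal.ofReal (Real.exp (-u)) := by
      intro u hu
      rw [Measure.map_apply hY (measurable_prodMk_left hE)]
      have : (∑ j ∈ s, X j) ⁻¹' (Prod.mk u ⁻¹' {p : ℝ × ℝ | t < p.1 + p.2}) = univ := by
        ext ω
        have h3 : 0 ≤ ∑ j ∈ s, X j ω := Finset.sum_nonneg fun j _ => h0 j ω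
        have h4 : t < u := hu
        simp only [mem_preimage, mem_ofPred_eq, Finset.sum_apply, mem_univ, iff_true]
        linarith
      rw [this, measure_univ, mul_one]
    rw [← Ioc_union_Ioi_eq_Ioi ht, lintegral_union measurableSet_Ioi
      (Ioc_disjoint_Ioi le_rfl), setLIntegral_congr_fun measurableSet_Ioc hsmall,
      setLIntegral_congr_fun measurableSet_Ioi hlarge, lintegral_exp_neg_Ioi t, erlangTail_succ,
      intervalIntegral.integral_of_le ht, ENNReal.ofReal_add _ (Real.exp_pos _).le,
      ofReal_integral_eq_lintegral_ofReal]
    · have hc := continuous_erlangTail s.card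
      exact (Continuous.integrableOn_Icc (by fun_prop)).mono_set Ioc_subset_Icc_self
    · filter_upwards [ae_restrict_mem measurableSet_Ioc] with u hu
      exact mul_nonneg (Real.exp_pos _).le (erlangTail_nonneg _ (sub_nonneg.2 hu.2))
    · exact setIntegral_nonneg measurableSet_Ioc fun u hu =>
        mul_nonneg (Real.exp_pos _).le (erlangTail_nonneg _ (sub_nonneg.2 hu.2))

end PZF

namespace PZF

/-! ### Circularly symmetric Gaussian vectors -/

lemma charFun_complexNormal (t : ℂ) :
    charFun complexNormal t = Complex.exp (-(‖t‖ ^ 2 : ℝ) / 4) := by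
  rw [charFun_apply, complexNormal, integral_map measurable_complex_mk.aemeasurable
    (Measurable.aestronglyMeasurable (by fun_prop))]
  have h1 : ∀ p : ℝ × ℝ, Complex.exp ((inner ℝ (⟨p.1, p.2⟩ : ℂ) t : ℝ) * Complex.I) =
      Complex.exp ((t.re : ℂ) * p.1 * Complex.I) * Complex.exp ((t.im : ℂ) * p.2 * Complex.I) := by
    intro p
    rw [← Complex.exp_add, Complex.inner]
    congr 1
    simp only [Complex.mul_re, Complex.conj_re, Complex.conj_im]
    push_cast
    ring
  simp_rw [h1]
  rw [integral_prod_mul (fun x : ℝ => Complex.exp ((t.re : ℂ) * x * Complex.I))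
    (fun y : ℝ => Complex.exp ((t.im : ℂ) * y * Complex.I)), ← charFun_apply_real,
    ← charFun_apply_real, charFun_gaussianReal, charFun_gaussianReal, ← Complex.exp_add,
    Complex.sq_norm, Complex.normSq_apply]
  congr 1
  push_cast
  ring

lemma charFun_complexNormalVec {N : ℕ} (t : EuclideanSpace ℂ (Fin N)) :
    charFun (complexNormalVec N) t = Complex.exp (-(‖t‖ ^ 2 : ℝ) / 4) := by
  rw [complexNormalVec, charFun_pi]
  simp_rw [charFun_complexNormal]
  rw [← Complex.exp_sum, EuclideanSpace.norm_sq_eq, ← Finset.sum_div, Finset.sum_neg_distrib]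
  push_cast
  rfl

/-- Unitary invariance of the law `𝒞𝒩(0, I)`. -/
lemma map_complexNormalVec {N : ℕ}
    (U : EuclideanSpace ℂ (Fin N) ≃ₗᵢ[ℂ] EuclideanSpace ℂ (Fin N)) :
    (complexNormalVec N).map U = complexNormalVec N := by
  have hU : Measurable U := U.continuous.measurable
  have : IsProbabilityMeasure ((complexNormalVec N).map U) :=
    Measure.isProbabilityMeasure_map hU.aemeasurable
  -- characteristic functions are formed with the real inner product
  let V : EuclideanSpace ℂ (Fin N) ≃ₗᵢ[ℝ] EuclideanSpace ℂ (Fin N) :=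
    { U.toLinearEquiv.restrictScalars ℝ with norm_map' := U.norm_map }
  refine Measure.ext_of_charFun (funext fun t => ?_)
  have h1 : charFun ((complexNormalVec N).map U) t = charFun (complexNormalVec N) (V.symm t) := by
    rw [charFun_apply, charFun_apply, integral_map hU.aemeasurable
      (Measurable.aestronglyMeasurable (by fun_prop))]
    congr 1
    funext g
    rw [← V.inner_map_eq_flip]
    rfl
  rw [h1, charFun_complexNormalVec, charFun_complexNormalVec, V.symm.norm_map]

variable {N : ℕ}

/-- The energies of a `𝒞𝒩(0, I)` vector along the vectors of an orthonormal basis are jointly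
distributed as in the standard basis. -/
lemma map_normSq_inner_orthonormalBasis
    (b : OrthonormalBasis (Fin N) ℂ (EuclideanSpace ℂ (Fin N))) :
    (complexNormalVec N).map (fun g i => ‖inner ℂ (b i) g‖ ^ 2) =
      (Measure.pi fun _ : Fin N => complexNormal).map (fun z i => ‖z i‖ ^ 2) := by
  have h1 : (fun (g : EuclideanSpace ℂ (Fin N)) (i : Fin N) => ‖inner ℂ (b i) g‖ ^ 2) =
      (fun (g : EuclideanSpace ℂ (Fin N)) (i : Fin N) => ‖g i‖ ^ 2) ∘ b.repr := by
    funext g i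
    rw [Function.comp_apply, b.repr_apply_apply]
  have hm : Measurable (fun (g : EuclideanSpace ℂ (Fin N)) (i : Fin N) => ‖g i‖ ^ 2) := by
    fun_prop
  rw [h1, ← Measure.map_map hm b.repr.continuous.measurable, map_complexNormalVec,
    complexNormalVec, Measure.map_map hm (by fun_prop)]
  rfl

lemma map_normSq_inner {v : EuclideanSpace ℂ (Fin N)} (hv : ‖v‖ = 1) :
    (complexNormalVec N).map (fun g => ‖inner ℂ v g‖ ^ 2) = expMeasure 1 := by
  obtain ⟨i⟩ : Nonempty (Fin N) := by
    by_contra h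
    rw [not_nonempty_iff] at h
    rw [Subsingleton.elim v 0, norm_zero] at hv
    exact zero_ne_one hv
  have ho : Orthonormal ℂ (({i} : Set (Fin N)).domRestrict fun _ => v) :=
    ⟨fun _ => hv, fun j k hjk => absurd (Subsingleton.elim j k) hjk⟩
  obtain ⟨b, hb⟩ := ho.exists_orthonormalBasis_extension_of_card_eq (by simp)
  have hbi : b i = v := hb i rfl
  have h := congrArg (fun μ : Measure (Fin N → ℝ) => μ.map (fun y => y i))
    (map_normSq_inner_orthonormalBasis b)
  beta_reduce at h
  rw [Measure.map_map (by fun_prop) (by fun_prop), Measure.map_map (by fun_prop) (by fun_prop)] at h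
  have h2 : ((fun y : Fin N → ℝ => y i) ∘ fun (z : Fin N → ℂ) (i : Fin N) => ‖z i‖ ^ 2) =
      (fun z : ℂ => ‖z‖ ^ 2) ∘ (fun z : Fin N → ℂ => z i) := rfl
  rw [h2, ← Measure.map_map (g := fun z : ℂ => ‖z‖ ^ 2) (f := fun z : Fin N → ℂ => z i)
    (by fun_prop) (by fun_prop),
    (measurePreserving_eval (fun _ : Fin N => complexNormal) i).map_eq,
    map_normSq_complexNormal] at h
  rw [← h, ← hbi]
  rfl

/-- The energy of a `𝒞𝒩(0, I)` vector in an `m`-dimensional subspace is Gamma distributed with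
shape `m`. -/
lemma measure_lt_normSq_starProjection (V : Submodule ℂ (EuclideanSpace ℂ (Fin N))) {t : ℝ}
    (ht : 0 ≤ t) :
    complexNormalVec N {g | t < ‖V.starProjection g‖ ^ 2} =
      ENNReal.ofReal (erlangTail (Module.finrank ℂ V) t) := by
  classical
  set m := Module.finrank ℂ V with hm
  have hmN : m ≤ N := by simpa using Submodule.finrank_le V
  set e := stdOrthonormalBasis ℂ V with he
  set c : Fin m → Fin N := Fin.castLE hmN with hc
  have hinj : Function.Injective c := Fin.castLE_injective hmN
  -- extend an orthonormal basis of `V`, put at the indices `c j`, to one of the whole space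
  set v : Fin N → EuclideanSpace ℂ (Fin N) := Function.extend c (fun j => (e j : _)) 0 with hv
  have ho : Orthonormal ℂ ((range c).domRestrict v) := by
    have h1 : Orthonormal ℂ (fun j => (e j : EuclideanSpace ℂ (Fin N))) :=
      e.orthonormal.comp_linearIsometry V.subtypeₗᵢ
    have h2 := h1.comp (Equiv.ofInjective c hinj).symm (Equiv.injective _)
    convert! h2 using 1
    funext ⟨_, j, rfl⟩
    simp [v, hinj.extend_apply]
  obtain ⟨b, hb⟩ := ho.exists_orthonormalBasis_extension_of_card_eq (by simp)
  have hbj : ∀ j, b (c j) = e j := fun j => by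
    rw [hb _ ⟨j, rfl⟩, hv, hinj.extend_apply]
  have hnorm : ∀ g, ‖V.starProjection g‖ ^ 2 =
      ∑ i ∈ Finset.univ.map ⟨c, hinj⟩, ‖inner ℂ (b i) g‖ ^ 2 := by
    intro g
    rw [Submodule.starProjection_apply, Submodule.norm_coe, ← e.sum_sq_norm_inner_right,
      Finset.sum_map]
    refine Finset.sum_congr rfl fun j _ => ?_
    rw [Submodule.inner_orthogonalProjectionOnto_eq_of_mem_left]
    change _ = ‖inner ℂ (b (c j)) g‖ ^ 2
    rw [hbj]
  set s := Finset.univ.map (⟨c, hinj⟩ : Fin m ↪ Fin N) with hs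
  have hcard : s.card = m := by simp [s]
  have hE : MeasurableSet {y : Fin N → ℝ | t < ∑ i ∈ s, y i} :=
    measurableSet_lt measurable_const (by fun_prop)
  have h := congrArg (fun μ : Measure (Fin N → ℝ) => μ {y : Fin N → ℝ | t < ∑ i ∈ s, y i})
    (map_normSq_inner_orthonormalBasis b)
  beta_reduce at h
  rw [Measure.map_apply (by fun_prop) hE, Measure.map_apply (by fun_prop) hE] at h
  simp_rw [hnorm]
  refine h.trans ?_
  rw [← hcard]
  refine measure_lt_sum_of_iIndepFun_exp (X := fun i (z : Fin N → ℂ) => ‖z i‖ ^ 2)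
    (fun i => by fun_prop) (fun i z => by positivity) (fun i => ?_) ?_ s ht
  · have h2 : (fun z : Fin N → ℂ => ‖z i‖ ^ 2) =
      (fun z : ℂ => ‖z‖ ^ 2) ∘ (fun z : Fin N → ℂ => z i) := rfl
    rw [h2, ← Measure.map_map (by fun_prop) (by fun_prop),
      (measurePreserving_eval (fun _ : Fin N => complexNormal) i).map_eq,
      map_normSq_complexNormal]
  · exact iIndepFun_pi (μ := fun _ : Fin N => complexNormal) (X := fun _ (z : ℂ) => ‖z‖ ^ 2)
      fun i => Measurable.aemeasurable (by fun_prop)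

lemma erlangTail_zero {m : ℕ} (hm : 1 ≤ m) : erlangTail m 0 = 1 := by
  obtain ⟨k, rfl⟩ := Nat.exists_eq_add_of_le' hm
  rw [erlangTail, Finset.sum_range_succ']
  simp

/-- A proper subspace is a null set: the energy in its orthogonal complement is Erlang
distributed, hence almost surely positive. -/
lemma complexNormalVec_submodule_eq_zero (V : Submodule ℂ (EuclideanSpace ℂ (Fin N)))
    (hV : Module.finrank ℂ V < N) : complexNormalVec N {g | g ∈ V} = 0 := by
  have hdim := V.finrank_add_finrank_orthogonal
  rw [finrank_euclideanSpace_fin] at hdim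
  have h1 := measure_lt_normSq_starProjection Vᗮ le_rfl
  rw [erlangTail_zero (by omega), ENNReal.ofReal_one] at h1
  have hm : MeasurableSet {g : EuclideanSpace ℂ (Fin N) | 0 < ‖Vᗮ.starProjection g‖ ^ 2} :=
    measurableSet_lt (by fun_prop) (by fun_prop)
  refine measure_mono_null ?_ ((prob_compl_eq_zero_iff hm).2 h1)
  intro g hg h
  rw [mem_ofPred_eq, Submodule.starProjection_orthogonal_val] at h
  rw [Submodule.starProjection_eq_self_iff.2 hg] at h
  simp at h

/-! ### The residual after projection -/

lemma measurable_gramSchmidt {n : ℕ} (k : Fin n) :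
    Measurable fun f : Fin n → EuclideanSpace ℂ (Fin N) =>
      InnerProductSpace.gramSchmidt ℂ f k := by
  induction k using WellFoundedLT.induction with
  | ind k ih =>
    simp_rw [InnerProductSpace.gramSchmidt_def ℂ (E := EuclideanSpace ℂ (Fin N)) _ k, Submodule.starProjection_singleton]
    refine (measurable_pi_apply k).sub (Finset.measurable_sum _ fun i hi => ?_)
    have hi' := ih i (Finset.mem_Iio.1 hi)
    refine Measurable.smul (Measurable.div (Measurable.inner (𝕜 := ℂ) hi' (measurable_pi_apply k)) ?_) hi'
    exact Complex.measurable_ofReal.comp (hi'.norm.pow_const 2)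

/-- The component of `g` orthogonal to the vectors `w` is the last Gram–Schmidt vector of
`(w, g)`. -/
lemma starProjection_orthogonal_eq_gramSchmidt {M : ℕ} (w : Fin M → EuclideanSpace ℂ (Fin N))
    (g : EuclideanSpace ℂ (Fin N)) :
    (Submodule.span ℂ (range w))ᗮ.starProjection g =
      InnerProductSpace.gramSchmidt ℂ (Fin.snoc (α := fun _ => EuclideanSpace ℂ (Fin N)) w g)
        (Fin.last M) := by
  set f : Fin (M + 1) → EuclideanSpace ℂ (Fin N) := Fin.snoc w g with hf
  have hg : f (Fin.last M) = g := by simp [f]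
  have himg : f '' Iio (Fin.last M) = range w := by
    ext y
    constructor
    · rintro ⟨i, hi, rfl⟩
      obtain ⟨j, rfl⟩ := Fin.exists_castSucc_eq.2 (ne_of_lt hi)
      exact ⟨j, by simp [f]⟩
    · rintro ⟨j, rfl⟩
      exact ⟨j.castSucc, Fin.castSucc_lt_last j, by simp [f]⟩
  have hspan := InnerProductSpace.span_gramSchmidt_Iio ℂ f (Fin.last M)
  rw [himg] at hspan
  have hdef := InnerProductSpace.gramSchmidt_def' ℂ f (Fin.last M)
  rw [hg] at hdef
  refine Submodule.eq_starProjection_of_mem_orthogonal' (K := (Submodule.span ℂ (range w))ᗮ)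
    (u := g) ?_ ?_ hdef
  · rw [← hspan, Submodule.mem_orthogonal]
    intro u hu
    induction hu using Submodule.span_induction with
    | mem u hu =>
      obtain ⟨i, hi, rfl⟩ := hu
      exact InnerProductSpace.gramSchmidt_orthogonal ℂ f (ne_of_lt hi)
    | zero => simp
    | add a b _ _ ha hb => rw [inner_add_left, ha, hb, add_zero]
    | smul a b _ hb => rw [inner_smul_left, hb, mul_zero]
  · rw [Submodule.orthogonal_orthogonal, ← hspan]
    refine Submodule.sum_mem _ fun i hi => ?_
    refine Submodule.span_mono ?_ (Submodule.starProjection_apply_mem _ _)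
    rw [singleton_subset_iff]
    exact ⟨i, Finset.mem_Iio.1 hi, rfl⟩

lemma measurable_starProjection_orthogonal_span {M : ℕ} :
    Measurable fun p : (Fin M → EuclideanSpace ℂ (Fin N)) × EuclideanSpace ℂ (Fin N) =>
      (Submodule.span ℂ (range p.1))ᗮ.starProjection p.2 := by
  simp_rw [starProjection_orthogonal_eq_gramSchmidt]
  refine (measurable_gramSchmidt (Fin.last M)).comp (measurable_pi_lambda _ fun i => ?_)
  refine Fin.lastCases ?_ (fun j => ?_) i
  · simpa using measurable_snd
  · simpa using measurable_fst.eval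

lemma starProjection_orthogonal_eq_zero_iff (V : Submodule ℂ (EuclideanSpace ℂ (Fin N)))
    (g : EuclideanSpace ℂ (Fin N)) : Vᗮ.starProjection g = 0 ↔ g ∈ V := by
  rw [Submodule.starProjection_orthogonal_val, sub_eq_zero, eq_comm,
    Submodule.starProjection_eq_self_iff]

/-! ### Independence of Gaussian vectors -/

lemma comap_tuple_le {Ω ι κ β : Type*} [MeasurableSpace β] (f : ι → Ω → β) (c : κ → ι) :
    MeasurableSpace.comap (fun ω i => f (c i) ω) MeasurableSpace.pi ≤
      ⨆ n ∈ range c, MeasurableSpace.comap (f n) inferInstance := by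
  rw [← measurable_iff_comap_le]
  refine @measurable_pi_lambda _ _ _ (_) _ _ fun i => ?_
  rw [measurable_iff_comap_le]
  exact le_iSup₂_of_le (c i) ⟨i, rfl⟩ le_rfl

/-- Subfamilies of an independent family along disjoint, possibly infinite, sets of indices are
independent. -/
lemma indepFun_comp_of_disjoint {Ω ι κ κ' β : Type*} [MeasurableSpace Ω] [MeasurableSpace β]
    {μ : Measure Ω} {f : ι → Ω → β} (hf : iIndepFun f μ) (hm : ∀ i, Measurable (f i))
    (a : κ → ι) (b : κ' → ι) (hab : ∀ i j, a i ≠ b j) :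
    IndepFun (fun ω i => f (a i) ω) (fun ω j => f (b j) ω) μ := by
  have h := indep_iSup_of_disjoint (fun i => (hm i).comap_le) hf
    (S := range a) (T := range b) (Set.disjoint_left.2 (by
      rintro _ ⟨i, rfl⟩ ⟨j, hj⟩
      exact hab i j hj.symm))
  rw [IndepFun_iff_Indep]
  exact indep_of_indep_of_le_left (indep_of_indep_of_le_right h (comap_tuple_le f b))
    (comap_tuple_le f a)

/-- At most `N` independent `𝒞𝒩(0, I)` vectors in `ℂᴺ` are almost surely linearly independent. -/
lemma ae_linearIndependent {Ω : Type*} [MeasurableSpace Ω] {μ : Measure Ω} [IsProbabilityMeasure μ]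
    {n : ℕ} (hn : n ≤ N) {f : Fin n → Ω → EuclideanSpace ℂ (Fin N)} (hm : ∀ k, Measurable (f k))
    (hlaw : ∀ k, μ.map (f k) = complexNormalVec N) (hind : iIndepFun f μ) :
    ∀ᵐ ω ∂μ, LinearIndependent ℂ fun k => f k ω := by
  induction n with
  | zero => exact Filter.Eventually.of_forall fun ω => linearIndependent_empty_type
  | succ n ih =>
    have ih' := ih (Nat.le_of_succ_le hn) (f := fun k => f k.castSucc) (fun k => hm _)
      (fun k => hlaw _) (hind.precomp (Fin.castSucc_injective n))
    set W : Ω → (Fin n → EuclideanSpace ℂ (Fin N)) := fun ω k => f k.castSucc ω with hW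
    have hWm : Measurable W := measurable_pi_lambda _ fun k => hm _
    have hindW : IndepFun W (f (Fin.last n)) μ :=
      (indepFun_comp_of_disjoint hind hm Fin.castSucc (fun _ : Unit => Fin.last n)
        (fun i _ => (Fin.castSucc_lt_last i).ne)).comp (φ := id)
        (ψ := fun y : Unit → EuclideanSpace ℂ (Fin N) => y ())
        measurable_id (measurable_pi_apply ())
    have hprod := (indepFun_iff_map_prod_eq_prod_map_map hWm.aemeasurable
      (hm (Fin.last n)).aemeasurable).1 hindW
    rw [hlaw] at hprod
    have hE : MeasurableSet {p : (Fin n → EuclideanSpace ℂ (Fin N)) × EuclideanSpace ℂ (Fin N) |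
        p.2 ∈ Submodule.span ℂ (range p.1)} := by
      simp_rw [← starProjection_orthogonal_eq_zero_iff]
      exact measurable_starProjection_orthogonal_span (measurableSet_singleton 0)
    have hnull : ∀ᵐ ω ∂μ, f (Fin.last n) ω ∉ Submodule.span ℂ (range (W ω)) := by
      have h0 : μ.map (fun ω => (W ω, f (Fin.last n) ω))
          {p | p.2 ∈ Submodule.span ℂ (range p.1)} = 0 := by
        rw [hprod, Measure.measure_prod_null hE]
        filter_upwards with w
        refine complexNormalVec_submodule_eq_zero (Submodule.span ℂ (range w)) ?_
        have := finrank_range_le_card (R := ℂ) w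
        rw [Fintype.card_fin] at this
        exact lt_of_le_of_lt this (Nat.lt_of_succ_le hn)
      rw [Measure.map_apply (hWm.prodMk (hm _)) hE] at h0
      rw [ae_iff]
      simpa using h0
    filter_upwards [ih', hnull] with ω h1 h2
    have h3 : (fun k => f k ω) = Fin.snoc (α := fun _ => EuclideanSpace ℂ (Fin N)) (W ω)
        (f (Fin.last n) ω) := by
      funext k
      refine Fin.lastCases ?_ (fun j => ?_) k
      · simp
      · simp [W]
    rw [h3, linearIndependent_finSnoc]
    exact ⟨h1, h2⟩

end PZF

namespace PZF

/-! ### The path gain and its integrals -/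

/-- The path gain `ρ r^{-α}` at distance `r`, cut off at the distance `d` within which the
interferers are cancelled. -/
noncomputable def pathGain (d α ρ : ℝ) : ℝ → ℝ := (Ioi d).indicator fun r => ρ * r ^ (-α)

section pathGain

variable {d α ρ : ℝ}

lemma pathGain_nonneg (hd : 0 < d) (hρ : 0 < ρ) (r : ℝ) : 0 ≤ pathGain d α ρ r := by
  refine indicator_nonneg (fun r hr => ?_) r
  have : 0 < r := hd.trans hr
  positivity

lemma measurable_pathGain : Measurable (pathGain d α ρ) :=
  Measurable.indicator (by fun_prop) measurableSet_Ioi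

lemma lintegral_pathGain_ne_top (hd : 0 < d) (hα : 2 < α) :
    ∫⁻ y : Plane, ENNReal.ofReal (pathGain d α ρ ‖y‖) ≠ ∞ := by
  suffices h : Integrable fun y : Plane => pathGain d α ρ ‖y‖ from h.lintegral_lt_top.ne
  rw [integrable_plane_norm_iff]
  have h1 : (fun r => r * pathGain d α ρ r) = (Ioi d).indicator fun r => r * (ρ * r ^ (-α)) := by
    funext r
    by_cases hr : r ∈ Ioi d
    · rw [pathGain, indicator_of_mem hr, indicator_of_mem hr]
    · rw [pathGain, indicator_of_notMem hr, indicator_of_notMem hr, mul_zero]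
  rw [h1]
  refine Integrable.integrableOn ((integrable_indicator_iff measurableSet_Ioi).2 ?_)
  have h2 : EqOn (fun r => r * (ρ * r ^ (-α))) (fun r => ρ * r ^ (1 - α)) (Ioi d) := by
    intro r hr
    have hr0 : 0 < r := hd.trans hr
    simp only
    rw [sub_eq_add_neg, Real.rpow_add hr0, Real.rpow_one]
    ring
  rw [integrableOn_congr_fun h2 measurableSet_Ioi]
  exact (integrableOn_Ioi_rpow_of_lt (by linarith) hd).const_mul _

lemma integral_plane_pathGain (hd : 0 < d) (s : ℝ) :
    ∫ y : Plane, s * pathGain d α ρ ‖y‖ / (1 + s * pathGain d α ρ ‖y‖) =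
      2 * Real.pi * ∫ r in Ioi d, r * (s * ρ * r ^ (-α) / (1 + s * ρ * r ^ (-α))) := by
  rw [integral_plane_norm (fun r => s * pathGain d α ρ r / (1 + s * pathGain d α ρ r))]
  congr 1
  have h1 : (fun r => r * (s * pathGain d α ρ r / (1 + s * pathGain d α ρ r))) =
      (Ioi d).indicator fun r => r * (s * ρ * r ^ (-α) / (1 + s * ρ * r ^ (-α))) := by
    funext r
    by_cases hr : r ∈ Ioi d
    · rw [pathGain, indicator_of_mem hr, indicator_of_mem hr, mul_assoc s]
    · rw [pathGain, indicator_of_notMem hr, indicator_of_notMem hr]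
      simp
  rw [h1, setIntegral_indicator measurableSet_Ioi, Ioi_inter_Ioi, max_eq_right hd.le]

end pathGain

/-! ### Weighted sums of independent exponential variables -/

/-- The law of a sequence of independent unit exponential variables. -/
noncomputable def expSeq : Measure (ℕ → ℝ) := Measure.infinitePi fun _ => expMeasure 1

instance : IsProbabilityMeasure expSeq := by
  unfold expSeq
  infer_instance

lemma ae_nonneg_expMeasure : ∀ᵐ u ∂expMeasure 1, 0 ≤ u := by
  have h := lintegral_expMeasure_one (f := (Iio (0 : ℝ)).indicator 1)
    (measurable_one.indicator measurableSet_Iio)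
  rw [lintegral_indicator_one measurableSet_Iio] at h
  have h0 : expMeasure 1 (Iio 0) = 0 := by
    rw [h, ← lintegral_zero (μ := volume.restrict (Ioi (0 : ℝ)))]
    refine setLIntegral_congr_fun measurableSet_Ioi fun u hu => ?_
    rw [indicator_of_notMem (by simpa using le_of_lt hu), mul_zero]
  rw [ae_iff]
  simpa [Iio] using h0

/-- The Laplace transform `(1 + a)⁻¹` of the exponential law, in the form used for products. -/
lemma integral_exp_neg_ofReal_mul_expMeasure {a : ℝ} (ha : 0 ≤ a) :
    ∫ u, Real.exp (-(ENNReal.ofReal (a * u)).toReal) ∂expMeasure 1 =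
      Real.exp (-Real.log (1 + a)) := by
  rw [Real.exp_neg, Real.exp_log (by linarith), ← integral_exp_neg_mul_expMeasure ha]
  refine integral_congr_ae ?_
  filter_upwards [ae_nonneg_expMeasure] with u hu
  rw [ENNReal.toReal_ofReal (mul_nonneg ha hu)]

section expSeq

variable {a : ℕ → ℝ}

/-- Each term has mean `aᵢ`, so a summable sequence of weights gives an almost surely finite sum. -/
lemma tsum_mul_expSeq_ne_top (ha : ∀ i, 0 ≤ a i) (hsum : ∑' i, ENNReal.ofReal (a i) ≠ ∞) :
    ∀ᵐ t ∂expSeq, ∑' i, ENNReal.ofReal (a i * t i) ≠ ∞ := by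
  have hm : ∀ i, Measurable fun t : ℕ → ℝ => ENNReal.ofReal (a i * t i) := fun i => by fun_prop
  have h : ∫⁻ t, ∑' i, ENNReal.ofReal (a i * t i) ∂expSeq = ∑' i, ENNReal.ofReal (a i) := by
    rw [lintegral_tsum fun i => (hm i).aemeasurable]
    refine tsum_congr fun i => ?_
    simp_rw [ENNReal.ofReal_mul (ha i)]
    rw [lintegral_const_mul _ (by fun_prop),
      ← lintegral_map (f := fun u => ENNReal.ofReal u) (by fun_prop) (measurable_pi_apply i), expSeq,
      Measure.infinitePi_map_eval, lintegral_ofReal_expMeasure, mul_one]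
  filter_upwards [ae_lt_top (Measurable.tsum hm) (h ▸ hsum)] with t ht using ht.ne

lemma tsum_ofReal_log_ne_top (ha : ∀ i, 0 ≤ a i) (hsum : ∑' i, ENNReal.ofReal (a i) ≠ ∞) :
    ∑' i, ENNReal.ofReal (Real.log (1 + a i)) ≠ ∞ := by
  refine ne_top_of_le_ne_top hsum (ENNReal.tsum_le_tsum fun i => ENNReal.ofReal_le_ofReal ?_)
  have := Real.log_le_sub_one_of_pos (show 0 < 1 + a i by linarith [ha i])
  linarith

/-- Laplace transform of a weighted sum of independent exponential variables: the product of the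
factors `1 / (1 + aᵢ)`, written as an exponential. -/
lemma integral_exp_neg_tsum_expSeq (ha : ∀ i, 0 ≤ a i) (hsum : ∑' i, ENNReal.ofReal (a i) ≠ ∞) :
    ∫ t, Real.exp (-(∑' i, ENNReal.ofReal (a i * t i)).toReal) ∂expSeq =
      Real.exp (-(∑' i, ENNReal.ofReal (Real.log (1 + a i))).toReal) := by
  have hlog : ∀ i, 0 ≤ Real.log (1 + a i) := fun i => Real.log_nonneg (by linarith [ha i])
  have hn : ∀ n : ℕ, ∫ t, Real.exp (-(∑ i ∈ Finset.range n, ENNReal.ofReal (a i * t i)).toReal)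
      ∂expSeq = Real.exp (-(∑ i ∈ Finset.range n, ENNReal.ofReal (Real.log (1 + a i))).toReal) := by
    intro n
    have hind : iIndepFun (fun (i : Fin n) (t : ℕ → ℝ) => t i) expSeq :=
      (iIndepFun_infinitePi (P := fun _ : ℕ => expMeasure 1) (X := fun _ u => u)
        (fun _ => measurable_id)).precomp Fin.val_injective
    have h1 : (fun t : ℕ → ℝ =>
        Real.exp (-(∑ i ∈ Finset.range n, ENNReal.ofReal (a i * t i)).toReal)) =
        ∏ i : Fin n, (fun u => Real.exp (-(ENNReal.ofReal (a i * u)).toReal)) ∘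
          fun t : ℕ → ℝ => t i := by
      funext t
      rw [ENNReal.toReal_sum fun i _ => ENNReal.ofReal_ne_top, ← Finset.sum_neg_distrib,
        Real.exp_sum, Finset.prod_range, Finset.prod_apply]
      rfl
    rw [h1, hind.integral_prod_comp (fun i => (measurable_pi_apply _).aemeasurable)
      (fun i => Measurable.aestronglyMeasurable (by fun_prop)),
      ENNReal.toReal_sum fun i _ => ENNReal.ofReal_ne_top, ← Finset.sum_neg_distrib,
      Real.exp_sum, Finset.prod_range]
    refine Finset.prod_congr rfl fun i _ => ?_
    rw [ENNReal.toReal_ofReal (hlog i), ← integral_exp_neg_ofReal_mul_expMeasure (ha i),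
      ← Measure.infinitePi_map_eval (fun _ : ℕ => expMeasure 1) (i : ℕ),
      integral_map (measurable_pi_apply _).aemeasurable
        (Measurable.aestronglyMeasurable (by fun_prop))]
    rfl
  have hR := (Real.continuous_exp.tendsto _).comp
    ((ENNReal.tendsto_toReal (tsum_ofReal_log_ne_top ha hsum)).comp
      (ENNReal.tendsto_nat_tsum fun i => ENNReal.ofReal (Real.log (1 + a i)))).neg
  refine tendsto_nhds_unique ?_ (hR.congr fun n => (hn n).symm)
  refine tendsto_integral_of_dominated_convergence (fun _ => 1) ?_ (integrable_const _) ?_ ?_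
  · intro n
    exact Measurable.aestronglyMeasurable (by fun_prop)
  · intro n
    filter_upwards with t
    rw [Real.norm_eq_abs, Real.abs_exp, Real.exp_le_one_iff, neg_nonpos]
    exact ENNReal.toReal_nonneg
  · filter_upwards [tsum_mul_expSeq_ne_top ha hsum] with t ht
    exact (Real.continuous_exp.tendsto _).comp
      ((ENNReal.tendsto_toReal ht).comp (ENNReal.tendsto_nat_tsum _)).neg

end expSeq

/-! ### The combining vector -/

section combiner

variable {N M : ℕ}

/-- The component of `p.2` orthogonal to the vectors `p.1`. -/
noncomputable def residual (p : (Fin M → EuclideanSpace ℂ (Fin N)) × EuclideanSpace ℂ (Fin N)) :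
    EuclideanSpace ℂ (Fin N) :=
  (Submodule.span ℂ (range p.1))ᗮ.starProjection p.2

/-- The normalized residual; it is `0` where the residual vanishes. -/
noncomputable def direction (p : (Fin M → EuclideanSpace ℂ (Fin N)) × EuclideanSpace ℂ (Fin N)) :
    EuclideanSpace ℂ (Fin N) :=
  ((‖residual p‖⁻¹ : ℝ) : ℂ) • residual p

lemma measurable_residual : Measurable (residual (N := N) (M := M)) :=
  measurable_starProjection_orthogonal_span

lemma measurable_direction : Measurable (direction (N := N) (M := M)) :=
  (Complex.measurable_ofReal.comp measurable_residual.norm.inv).smul measurable_residual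

lemma norm_direction {p : (Fin M → EuclideanSpace ℂ (Fin N)) × EuclideanSpace ℂ (Fin N)}
    (hp : residual p ≠ 0) : ‖direction p‖ = 1 := by
  rw [direction, norm_smul, Complex.norm_real, norm_inv, norm_norm,
    inv_mul_cancel₀ (norm_ne_zero_iff.2 hp)]

lemma norm_inner_direction (p : (Fin M → EuclideanSpace ℂ (Fin N)) × EuclideanSpace ℂ (Fin N)) :
    ‖inner ℂ (direction p) p.2‖ = ‖residual p‖ := by
  have h1 : inner ℂ (residual p) p.2 = ((‖residual p‖ ^ 2 : ℝ) : ℂ) := by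
    have h2 : inner ℂ (residual p) (residual p) = inner ℂ (residual p) p.2 := by
      conv_lhs => rw [residual]
      rw [← Submodule.inner_starProjection_left_eq_right,
        Submodule.starProjection_eq_self_iff.2 (Submodule.starProjection_apply_mem _ _)]
      rfl
    rw [← h2, inner_self_eq_norm_sq_to_K]
    norm_cast
  rw [direction, inner_smul_left, h1, Complex.conj_ofReal, ← Complex.ofReal_mul,
    Complex.norm_real, Real.norm_eq_abs, abs_of_nonneg (by positivity)]
  rcases eq_or_ne ‖residual p‖ 0 with h | h
  · rw [h]; simp
  · field_simp

end combiner

end PZF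

namespace PZF

/-! ### Joint law of the fading powers and the interference -/

/-- If `Z` and `G` are independent and `F z G` has the law `ν` for almost every value `z` of `Z`,
then `F Z G` is independent of `Z` with law `ν`. -/
lemma map_prodMk_of_fiberwise_law {Ω 𝓩 𝓖 𝓣 : Type*} [MeasurableSpace Ω] [MeasurableSpace 𝓩]
    [MeasurableSpace 𝓖] [MeasurableSpace 𝓣] {μ : Measure Ω} [IsProbabilityMeasure μ] {Z : Ω → 𝓩}
    {G : Ω → 𝓖} (hZ : Measurable Z) (hG : Measurable G) (hind : IndepFun Z G μ) {F : 𝓩 → 𝓖 → 𝓣}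
    (hF : Measurable (Function.uncurry F)) {ν : Measure 𝓣} [SFinite ν]
    (hν : ∀ᵐ ω ∂μ, (μ.map G).map (F (Z ω)) = ν) :
    μ.map (fun ω => (Z ω, F (Z ω) (G ω))) = (μ.map Z).prod ν := by
  have hprod := (indepFun_iff_map_prod_eq_prod_map_map hZ.aemeasurable hG.aemeasurable).1 hind
  have : IsProbabilityMeasure (μ.map G) := Measure.isProbabilityMeasure_map hG.aemeasurable
  have hF' : Measurable fun p : 𝓩 × 𝓖 => (p.1, F p.1 p.2) := measurable_fst.prodMk hF
  ext A hA
  have h1 : (fun ω => (Z ω, F (Z ω) (G ω))) = (fun p : 𝓩 × 𝓖 => (p.1, F p.1 p.2)) ∘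
    fun ω => (Z ω, G ω) := rfl
  rw [h1, ← Measure.map_map hF' (hZ.prodMk hG), hprod, Measure.map_apply hF' hA,
    Measure.prod_apply (hF' hA), Measure.prod_apply hA,
    lintegral_map (measurable_measure_prodMk_left (hF' hA)) hZ,
    lintegral_map (measurable_measure_prodMk_left hA) hZ]
  refine lintegral_congr_ae ?_
  filter_upwards [hν] with ω hω
  have hFω : Measurable (F (Z ω)) := hF.comp measurable_prodMk_left
  rw [← hω, Measure.map_apply hFω (measurable_prodMk_left hA)]
  rfl

variable {Ω : Type*} [MeasurableSpace Ω] {P : Measure Ω} [IsProbabilityMeasure P] {N M : ℕ}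
  {lam α ρ ρ₀ R₀ θ : ℝ} {x : ℕ → Ω → Plane} {h₀ : Ω → EuclideanSpace ℂ (Fin N)}
  {H : Fin M → Ω → EuclideanSpace ℂ (Fin N)} {h : ℕ → Ω → EuclideanSpace ℂ (Fin N)}

/-- The vectors that determine the combining vector: those to be cancelled and the desired one. -/
def designVectors {Ω : Type*} {N M : ℕ} (h₀ : Ω → EuclideanSpace ℂ (Fin N))
    (H : Fin M → Ω → EuclideanSpace ℂ (Fin N)) (ω : Ω) :
    (Fin M → EuclideanSpace ℂ (Fin N)) × EuclideanSpace ℂ (Fin N) :=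
  (fun k => H k ω, h₀ ω)

lemma fading_self_eq {Ω : Type*} {N M : ℕ} (h₀ : Ω → EuclideanSpace ℂ (Fin N))
    (H : Fin M → Ω → EuclideanSpace ℂ (Fin N)) (ω : Ω) :
    fading h₀ H h₀ ω = ‖residual (designVectors h₀ H ω)‖ ^ 2 := by
  rw [← norm_inner_direction]
  rfl

lemma measurable_designVectors (hm : ∀ j, Measurable (channels h₀ H h j)) :
    Measurable (designVectors h₀ H) :=
  (measurable_pi_lambda _ fun k => hm (Sum.inr (Sum.inl k))).prodMk (hm (Sum.inl ()))

lemma measurable_fading (hm : ∀ j, Measurable (channels h₀ H h j)) (i : ℕ) :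
    Measurable (fading h₀ H (h i)) :=
  (Measurable.inner (𝕜 := ℂ) (measurable_direction.comp (measurable_designVectors hm))
    (hm (Sum.inr (Sum.inr i)))).norm.pow_const 2

namespace IsNetwork

lemma ae_linearIndependent (hnet : IsNetwork P lam x h₀ H h)
    (hm : ∀ j, Measurable (channels h₀ H h j)) (hMN : M < N) :
    ∀ᵐ ω ∂P, LinearIndependent ℂ (fun k => H k ω) ∧ residual (designVectors h₀ H ω) ≠ 0 := by
  set idx : Fin (M + 1) → Unit ⊕ (Fin M ⊕ ℕ) :=
    Fin.snoc (α := fun _ => Unit ⊕ (Fin M ⊕ ℕ)) (fun k => Sum.inr (Sum.inl k)) (Sum.inl ())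
    with hidx
  have hinj : Function.Injective idx := by
    intro i j
    refine Fin.lastCases ?_ (fun i => ?_) i <;> refine Fin.lastCases ?_ (fun j => ?_) j <;>
      simp [idx]
  have h1 := PZF.ae_linearIndependent (μ := P) (Nat.succ_le_of_lt hMN)
    (f := fun k => channels h₀ H h (idx k)) (fun k => hm _) (fun k => (hnet.law _).map_eq)
    (hnet.indep.precomp hinj)
  filter_upwards [h1] with ω hω
  have h2 : (fun k => channels h₀ H h (idx k) ω) =
      Fin.snoc (α := fun _ => EuclideanSpace ℂ (Fin N)) (fun k => H k ω) (h₀ ω) := by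
    funext k
    refine Fin.lastCases ?_ (fun j => ?_) k <;> simp [idx, channels]
  rw [h2, linearIndependent_finSnoc] at hω
  exact ⟨hω.1, fun h0 => hω.2 ((starProjection_orthogonal_eq_zero_iff _ _).1 h0)⟩

/-- For a fixed unit vector `v` the powers `|vᴴhᵢ|²` are independent exponential variables, so they
are independent of the vectors from which `v` is formed. -/
lemma map_designVectors_fading (hnet : IsNetwork P lam x h₀ H h)
    (hm : ∀ j, Measurable (channels h₀ H h j)) (hMN : M < N) :
    P.map (fun ω => (designVectors h₀ H ω, fun i => fading h₀ H (h i) ω)) =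
      (P.map (designVectors h₀ H)).prod expSeq := by
  have hZ := measurable_designVectors hm
  have hG : Measurable fun ω i => h i ω :=
    measurable_pi_lambda _ fun i => hm (Sum.inr (Sum.inr i))
  have hind : IndepFun (designVectors h₀ H) (fun ω i => h i ω) P :=
    (indepFun_comp_of_disjoint hnet.indep hm
      (Sum.elim (fun _ : Unit => Sum.inl ()) (fun k : Fin M => Sum.inr (Sum.inl k)))
      (fun i : ℕ => Sum.inr (Sum.inr i)) (by rintro (_ | _) _ <;> simp)).comp
      (φ := fun y : Unit ⊕ Fin M → EuclideanSpace ℂ (Fin N) =>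
        ((fun k => y (Sum.inr k) : Fin M → EuclideanSpace ℂ (Fin N)), y (Sum.inl ())))
      (ψ := id) (by fun_prop) measurable_id
  have hlawG : P.map (fun ω i => h i ω) = Measure.infinitePi fun _ => complexNormalVec N := by
    have h1 := (hnet.indep.precomp (g := fun i : ℕ => Sum.inr (Sum.inr i))
      (fun i j hij => by simpa using hij)).map_fun_eq_infinitePi_map (fun i => hm _)
    refine h1.trans ?_
    congr 1
    funext i
    exact (hnet.law (Sum.inr (Sum.inr i))).map_eq
  refine map_prodMk_of_fiberwise_law hZ hG hind
    (F := fun z g i => ‖inner ℂ (direction z) (g i)‖ ^ 2) ?_ ?_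
  · refine measurable_pi_lambda _ fun i => ?_
    exact (Measurable.inner (𝕜 := ℂ) (measurable_direction.comp measurable_fst)
      ((measurable_pi_apply i).comp measurable_snd)).norm.pow_const 2
  · filter_upwards [hnet.ae_linearIndependent hm hMN] with ω hω
    rw [hlawG, Measure.infinitePi_map_pi (fun _ : ℕ => complexNormalVec N)
      (f := fun _ g => ‖inner ℂ (direction (designVectors h₀ H ω)) g‖ ^ 2)
      (fun i => by fun_prop)]
    simp_rw [map_normSq_inner (norm_direction hω.2)]
    rfl

/-- The fading power of the desired signal is Gamma distributed with shape `N - M`. -/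
lemma measure_lt_normSq_residual (hnet : IsNetwork P lam x h₀ H h)
    (hm : ∀ j, Measurable (channels h₀ H h j)) (hMN : M < N) {t : ℝ} (ht : 0 ≤ t) :
    P.map (designVectors h₀ H) {z | t < ‖residual z‖ ^ 2} =
      ENNReal.ofReal (erlangTail (N - M) t) := by
  have hW : Measurable fun ω k => H k ω := measurable_pi_lambda _ fun k => hm (Sum.inr (Sum.inl k))
  have hm0 : Measurable h₀ := hm (Sum.inl ())
  have hind : IndepFun (fun ω k => H k ω) h₀ P :=
    (indepFun_comp_of_disjoint hnet.indep hm (fun k : Fin M => Sum.inr (Sum.inl k))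
      (fun _ : Unit => Sum.inl ()) (by simp)).comp
      (φ := id) (ψ := fun y : Unit → EuclideanSpace ℂ (Fin N) => y ())
      measurable_id (measurable_pi_apply ())
  have hprod := (indepFun_iff_map_prod_eq_prod_map_map hW.aemeasurable hm0.aemeasurable).1 hind
  have hlaw0 : P.map h₀ = complexNormalVec N := (hnet.law (Sum.inl ())).map_eq
  have hE : MeasurableSet {z : (Fin M → EuclideanSpace ℂ (Fin N)) × EuclideanSpace ℂ (Fin N) |
      t < ‖residual z‖ ^ 2} :=
    measurableSet_lt measurable_const (measurable_residual.norm.pow_const 2)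
  have hae : ∀ᵐ ω ∂P, complexNormalVec N (Prod.mk (fun k => H k ω) ⁻¹' {z | t < ‖residual z‖ ^ 2}) =
      ENNReal.ofReal (erlangTail (N - M) t) := by
    filter_upwards [hnet.ae_linearIndependent hm hMN] with ω hω
    have hdim := (Submodule.span ℂ (range fun k => H k ω)).finrank_add_finrank_orthogonal
    rw [finrank_euclideanSpace_fin, finrank_span_eq_card hω.1, Fintype.card_fin] at hdim
    have h1 := measure_lt_normSq_starProjection (Submodule.span ℂ (range fun k => H k ω))ᗮ ht
    rw [show Module.finrank ℂ (Submodule.span ℂ (range fun k => H k ω))ᗮ = N - M by omega] at h1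
    exact h1
  change P.map (fun ω => ((fun k => H k ω), h₀ ω)) _ = _
  rw [hprod, hlaw0, Measure.prod_apply hE,
    lintegral_map (measurable_measure_prodMk_left hE) hW, lintegral_congr_ae hae]
  simp

end IsNetwork

/-- The interference as a function of the points and of the fading powers. -/
noncomputable def weightedSum (d α ρ : ℝ) (p : (ℕ → Plane) × (ℕ → ℝ)) : ℝ≥0∞ :=
  ∑' i, ENNReal.ofReal (pathGain d α ρ ‖p.1 i‖ * p.2 i)

lemma measurable_weightedSum (d α ρ : ℝ) : Measurable (weightedSum d α ρ) := by
  refine Measurable.tsum fun i => ?_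
  have h1 : Measurable fun p : (ℕ → Plane) × (ℕ → ℝ) => p.1 i :=
    (measurable_pi_apply i).comp measurable_fst
  have h2 : Measurable fun p : (ℕ → Plane) × (ℕ → ℝ) => p.2 i :=
    (measurable_pi_apply i).comp measurable_snd
  exact ((measurable_pathGain.comp h1.norm).mul h2).ennreal_ofReal

lemma interference_eq_weightedSum {Ω : Type*} {N M : ℕ} (lam α ρ : ℝ) (x : ℕ → Ω → Plane)
    (h₀ : Ω → EuclideanSpace ℂ (Fin N)) (H : Fin M → Ω → EuclideanSpace ℂ (Fin N))
    (h : ℕ → Ω → EuclideanSpace ℂ (Fin N)) (ω : Ω) :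
    interference lam α ρ x h₀ H h ω =
      weightedSum (meanDist lam M) α ρ (fun i => x i ω, fun i => fading h₀ H (h i) ω) := by
  refine tsum_congr fun i => ?_
  split_ifs with hi
  · rw [pathGain, indicator_of_mem (mem_Ioi.2 hi), mul_assoc]
  · rw [pathGain, indicator_of_notMem (by simpa using hi)]
    simp

namespace IsNetwork

/-- Points, design vectors and fading powers are independent. -/
lemma map_points_designVectors_fading (hnet : IsNetwork P lam x h₀ H h)
    (hm : ∀ j, Measurable (channels h₀ H h j)) (hMN : M < N) :
    P.map (fun ω => ((fun i => x i ω), (designVectors h₀ H ω, fun i => fading h₀ H (h i) ω))) =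
      (P.map fun ω i => x i ω).prod ((P.map (designVectors h₀ H)).prod expSeq) := by
  have hX : Measurable fun ω i => x i ω := measurable_pi_lambda _ hnet.poisson.measurable
  have hZT : Measurable fun ω => (designVectors h₀ H ω, fun i => fading h₀ H (h i) ω) :=
    (measurable_designVectors hm).prodMk (measurable_pi_lambda _ fun i => measurable_fading hm i)
  have hψ : Measurable fun c : Unit ⊕ (Fin M ⊕ ℕ) → EuclideanSpace ℂ (Fin N) =>
      (((fun k => c (Sum.inr (Sum.inl k)), c (Sum.inl ())) :
        (Fin M → EuclideanSpace ℂ (Fin N)) × EuclideanSpace ℂ (Fin N)),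
        fun i : ℕ => ‖inner ℂ (direction (N := N) (M := M)
          (fun k => c (Sum.inr (Sum.inl k)), c (Sum.inl ()))) (c (Sum.inr (Sum.inr i)))‖ ^ 2) := by
    have h1 : Measurable fun c : Unit ⊕ (Fin M ⊕ ℕ) → EuclideanSpace ℂ (Fin N) =>
        (((fun k => c (Sum.inr (Sum.inl k)), c (Sum.inl ())) :
        (Fin M → EuclideanSpace ℂ (Fin N)) × EuclideanSpace ℂ (Fin N))) := by fun_prop
    refine h1.prodMk (measurable_pi_lambda _ fun i => ?_)
    exact (Measurable.inner (𝕜 := ℂ) (measurable_direction.comp h1)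
      (measurable_pi_apply _)).norm.pow_const 2
  have hind := hnet.indep_points.comp measurable_id hψ
  have hprod := (indepFun_iff_map_prod_eq_prod_map_map hX.aemeasurable hZT.aemeasurable).1 hind
  rw [← hnet.map_designVectors_fading hm hMN, ← hprod]

lemma map_points_fading (hnet : IsNetwork P lam x h₀ H h)
    (hm : ∀ j, Measurable (channels h₀ H h j)) (hMN : M < N) :
    P.map (fun ω => ((fun i => x i ω), fun i => fading h₀ H (h i) ω)) =
      (P.map fun ω i => x i ω).prod expSeq := by
  have hX : Measurable fun ω i => x i ω := measurable_pi_lambda _ hnet.poisson.measurable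
  have hZ := measurable_designVectors hm
  have hT : Measurable fun ω i => fading h₀ H (h i) ω :=
    measurable_pi_lambda _ fun i => measurable_fading hm i
  have : IsProbabilityMeasure (P.map (designVectors h₀ H)) :=
    Measure.isProbabilityMeasure_map hZ.aemeasurable
  have h1 := congrArg (Measure.map (Prod.map (id : (ℕ → Plane) → _) Prod.snd))
    (hnet.map_points_designVectors_fading hm hMN)
  rw [Measure.map_map (measurable_id.prodMap measurable_snd) (hX.prodMk (hZ.prodMk hT)),
    ← Measure.map_prod_map _ _ measurable_id measurable_snd, Measure.map_id,
    Measure.map_snd_prod, measure_univ, one_smul] at h1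
  exact h1

/-- Finiteness of the interference, from Campbell's formula; `α > 2` makes the path gain
integrable. -/
lemma ae_interference_ne_top (hnet : IsNetwork P lam x h₀ H h)
    (hm : ∀ j, Measurable (channels h₀ H h j)) (hM : 1 ≤ M) (hMN : M < N) (hlam : 0 < lam)
    (hα : 2 < α) (hρ : 0 < ρ) :
    ∀ᵐ ω ∂P, interference lam α ρ x h₀ H h ω ≠ ∞ := by
  have hd := meanDist_pos hlam hM
  have hX : Measurable fun ω i => x i ω := measurable_pi_lambda _ hnet.poisson.measurable
  have hT : Measurable fun ω i => fading h₀ H (h i) ω :=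
    measurable_pi_lambda _ fun i => measurable_fading hm i
  have hS : MeasurableSet {p | weightedSum (meanDist lam M) α ρ p = ∞} :=
    measurable_weightedSum _ _ _ (measurableSet_singleton ∞)
  have hg : Measurable fun y : Plane => ENNReal.ofReal (pathGain (meanDist lam M) α ρ ‖y‖) :=
    (measurable_pathGain.comp measurable_norm).ennreal_ofReal
  have hnull : P.map (fun ω => ((fun i => x i ω), fun i => fading h₀ H (h i) ω))
      {p | weightedSum (meanDist lam M) α ρ p = ∞} = 0 := by
    rw [hnet.map_points_fading hm hMN, Measure.prod_apply hS,
      lintegral_map (measurable_measure_prodMk_left hS) hX]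
    refine (lintegral_congr_ae ?_).trans lintegral_zero
    filter_upwards [hnet.poisson.tsum_ne_top hlam hg (lintegral_pathGain_ne_top hd hα)] with ω hω
    have h1 := tsum_mul_expSeq_ne_top (fun i => pathGain_nonneg (α := α) hd hρ ‖x i ω‖) hω
    simp only [ae_iff, ne_eq, not_not] at h1
    exact h1
  rw [Measure.map_apply (hX.prodMk hT) hS] at hnull
  simp_rw [interference_eq_weightedSum, ae_iff, not_not]
  exact hnull

end IsNetwork

end PZF

namespace PZF

variable {Ω : Type*} [MeasurableSpace Ω] {P : Measure Ω} [IsProbabilityMeasure P] {N M : ℕ}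
  {lam α ρ ρ₀ R₀ θ : ℝ} {x : ℕ → Ω → Plane} {h₀ : Ω → EuclideanSpace ℂ (Fin N)}
  {H : Fin M → Ω → EuclideanSpace ℂ (Fin N)} {h : ℕ → Ω → EuclideanSpace ℂ (Fin N)}

/-! ### The Laplace transform of the interference -/

lemma measurable_interference (hx : ∀ i, Measurable (x i))
    (hm : ∀ j, Measurable (channels h₀ H h j)) :
    Measurable (interference lam α ρ x h₀ H h) := by
  simp_rw [funext (interference_eq_weightedSum lam α ρ x h₀ H h)]
  exact (measurable_weightedSum _ _ _).comp ((measurable_pi_lambda _ hx).prodMk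
    (measurable_pi_lambda _ fun i => measurable_fading hm i))

lemma mul_toReal_weightedSum {d s : ℝ} (hs : 0 ≤ s) (p : (ℕ → Plane) × (ℕ → ℝ)) :
    s * (weightedSum d α ρ p).toReal =
      (∑' i, ENNReal.ofReal (s * pathGain d α ρ ‖p.1 i‖ * p.2 i)).toReal := by
  have h1 : ∑' i, ENNReal.ofReal (s * pathGain d α ρ ‖p.1 i‖ * p.2 i) =
      ENNReal.ofReal s * weightedSum d α ρ p := by
    rw [weightedSum, ← ENNReal.tsum_mul_left]
    refine tsum_congr fun i => ?_
    rw [← ENNReal.ofReal_mul hs, mul_assoc]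
  rw [h1, ENNReal.toReal_mul, ENNReal.toReal_ofReal hs]

namespace IsNetwork

/-- Averaging over the fading powers turns the Laplace transform of the interference into the
Laplace functional of the point process at `log (1 + s · gain)`. -/
lemma integral_exp_neg_interference (hnet : IsNetwork P lam x h₀ H h)
    (hm : ∀ j, Measurable (channels h₀ H h j)) (hM : 1 ≤ M) (hMN : M < N) (hlam : 0 < lam)
    (hα : 2 < α) (hρ : 0 < ρ) {s : ℝ} (hs : 0 ≤ s) :
    ∫ ω, Real.exp (-(s * (interference lam α ρ x h₀ H h ω).toReal)) ∂P =
      laplaceClosedForm lam α ρ M s := by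
  have hd := meanDist_pos hlam hM
  set d := meanDist lam M with hd_def
  have hX : Measurable fun ω i => x i ω := measurable_pi_lambda _ hnet.poisson.measurable
  have hT : Measurable fun ω i => fading h₀ H (h i) ω :=
    measurable_pi_lambda _ fun i => measurable_fading hm i
  have : IsProbabilityMeasure (P.map fun ω i => x i ω) :=
    Measure.isProbabilityMeasure_map hX.aemeasurable
  have hJ : Measurable fun p : (ℕ → Plane) × (ℕ → ℝ) =>
      Real.exp (-(s * (weightedSum d α ρ p).toReal)) := by
    have := measurable_weightedSum d α ρ
    fun_prop
  have hJint : Integrable (fun p : (ℕ → Plane) × (ℕ → ℝ) =>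
      Real.exp (-(s * (weightedSum d α ρ p).toReal))) ((P.map fun ω i => x i ω).prod expSeq) := by
    refine Integrable.of_bound hJ.aestronglyMeasurable 1 (Filter.Eventually.of_forall fun p => ?_)
    rw [Real.norm_eq_abs, Real.abs_exp, Real.exp_le_one_iff, neg_nonpos]
    exact mul_nonneg hs ENNReal.toReal_nonneg
  have hgain : ∀ y : Plane, 0 ≤ s * pathGain d α ρ ‖y‖ := fun y =>
    mul_nonneg hs (pathGain_nonneg hd hρ _)
  have hgm : Measurable fun y : Plane => s * pathGain d α ρ ‖y‖ :=
    (measurable_pathGain.comp measurable_norm).const_mul s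
  have hgfin : ∫⁻ y : Plane, ENNReal.ofReal (s * pathGain d α ρ ‖y‖) ≠ ∞ := by
    have h1 : Measurable fun y : Plane => ENNReal.ofReal (pathGain d α ρ ‖y‖) :=
      (measurable_pathGain.comp measurable_norm).ennreal_ofReal
    simp_rw [ENNReal.ofReal_mul hs]
    rw [lintegral_const_mul _ h1]
    exact ENNReal.mul_ne_top ENNReal.ofReal_ne_top (lintegral_pathGain_ne_top hd hα)
  have hlogm : Measurable fun y : Plane =>
      ENNReal.ofReal (Real.log (1 + s * pathGain d α ρ ‖y‖)) :=
    (Real.measurable_log.comp (hgm.const_add 1)).ennreal_ofReal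
  have hlogfin : ∫⁻ y : Plane, ENNReal.ofReal (Real.log (1 + s * pathGain d α ρ ‖y‖)) ≠ ∞ := by
    refine ne_top_of_le_ne_top hgfin (lintegral_mono fun y => ENNReal.ofReal_le_ofReal ?_)
    have := Real.log_le_sub_one_of_pos (show 0 < 1 + s * pathGain d α ρ ‖y‖ by linarith [hgain y])
    linarith
  calc ∫ ω, Real.exp (-(s * (interference lam α ρ x h₀ H h ω).toReal)) ∂P
      = ∫ p, Real.exp (-(s * (weightedSum d α ρ p).toReal))
          ∂P.map (fun ω => ((fun i => x i ω), fun i => fading h₀ H (h i) ω)) := by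
        rw [integral_map (hX.prodMk hT).aemeasurable hJ.aestronglyMeasurable]
        simp_rw [interference_eq_weightedSum]
        rfl
    _ = ∫ ω, ∫ t, Real.exp (-(s * (weightedSum d α ρ (fun i => x i ω, t)).toReal)) ∂expSeq ∂P := by
        rw [hnet.map_points_fading hm hMN, integral_prod _ hJint,
          integral_map hX.aemeasurable hJint.aestronglyMeasurable.integral_prod_right']
    _ = ∫ ω, Real.exp (-(∑' i, ENNReal.ofReal
          (Real.log (1 + s * pathGain d α ρ ‖x i ω‖))).toReal) ∂P := by
        refine integral_congr_ae ?_
        filter_upwards [hnet.poisson.tsum_ne_top hlam hgm.ennreal_ofReal hgfin] with ω hω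
        rw [← integral_exp_neg_tsum_expSeq (fun i => hgain (x i ω)) hω]
        simp_rw [mul_toReal_weightedSum hs]
    _ = Real.exp (-(lam * ∫ y : Plane, (1 - Real.exp (-(ENNReal.ofReal
          (Real.log (1 + s * pathGain d α ρ ‖y‖))).toReal)))) :=
        hnet.poisson.integral_exp_neg_tsum hlam hlogm (fun _ => ENNReal.ofReal_ne_top) hlogfin
    _ = Real.exp (-(lam * ∫ y : Plane,
          s * pathGain d α ρ ‖y‖ / (1 + s * pathGain d α ρ ‖y‖))) := by
        congr 3
        refine integral_congr_ae (Filter.Eventually.of_forall fun y => ?_)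
        have h1 : 0 < 1 + s * pathGain d α ρ ‖y‖ := by linarith [hgain y]
        beta_reduce
        rw [ENNReal.toReal_ofReal (Real.log_nonneg (by linarith [hgain y])), Real.exp_neg,
          Real.exp_log h1]
        field_simp
        ring
    _ = laplaceClosedForm lam α ρ M s := by
        rw [integral_plane_pathGain hd, laplaceClosedForm,
          upsilon_eq_integral hlam hα hρ hM hs]
        congr 1
        ring

end IsNetwork

/-! ### Laplace transforms of nonnegative random variables -/

section Laplace

variable {Y : Ω → ℝ}

lemma Iio_subset_interior_integrableExpSet (hY : Measurable Y) (h0 : ∀ ω, 0 ≤ Y ω) :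
    Iio 0 ⊆ interior (integrableExpSet Y P) := by
  refine interior_maximal (fun t ht => ?_) isOpen_Iio
  refine Integrable.of_bound (Measurable.aestronglyMeasurable (by fun_prop)) 1
    (Filter.Eventually.of_forall fun ω => ?_)
  rw [Real.norm_eq_abs, Real.abs_exp, Real.exp_le_one_iff]
  exact mul_nonpos_of_nonpos_of_nonneg (le_of_lt ht) (h0 ω)

variable {L : ℝ → ℝ}

lemma eventuallyEq_mgf_neg {μ : Measure Ω}
    (hL : ∀ s, 0 ≤ s → ∫ ω, Real.exp (-(s * Y ω)) ∂μ = L s) {s : ℝ} (hs : 0 < s) :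
    L =ᶠ[nhds s] fun t => mgf Y μ (-t) := by
  filter_upwards [Ioi_mem_nhds hs] with t ht
  rw [← hL t (le_of_lt ht), mgf]
  simp_rw [neg_mul]

lemma contDiffOn_laplace
    (hL : ∀ s, 0 ≤ s → ∫ ω, Real.exp (-(s * Y ω)) ∂P = L s) (hY : Measurable Y) (h0 : ∀ ω, 0 ≤ Y ω) :
    ContDiffOn ℝ (⊤ : ℕ∞) L (Ioi 0) := by
  rintro s (hs : 0 < s)
  have h1 : AnalyticAt ℝ (mgf Y P) (-s) :=
    analyticAt_mgf (Iio_subset_interior_integrableExpSet hY h0 (neg_lt_zero.2 hs))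
  have h2 : ContDiffAt ℝ (⊤ : ℕ∞) (fun t => mgf Y P (-t)) s :=
    ContDiffAt.comp (g := mgf Y P) s h1.contDiffAt contDiffAt_id.neg
  exact (h2.congr_of_eventuallyEq (eventuallyEq_mgf_neg hL hs)).contDiffWithinAt

/-- Each derivative of the Laplace transform brings down a factor `-Y`, so the mean of the Erlang
tail at `s Y` is a finite sum of derivatives. -/
lemma integral_erlangTail_eq
    (hL : ∀ s, 0 ≤ s → ∫ ω, Real.exp (-(s * Y ω)) ∂P = L s) (hY : Measurable Y) (h0 : ∀ ω, 0 ≤ Y ω) {s : ℝ} (hs : 0 < s)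
    (m : ℕ) :
    ∫ ω, erlangTail m (s * Y ω) ∂P =
      ∑ n ∈ Finset.range m, (-s) ^ n / n.factorial * iteratedDeriv n L s := by
  have hint := Iio_subset_interior_integrableExpSet (P := P) hY h0 (neg_lt_zero.2 hs)
  have h1 : ∀ n ω, (s * Y ω) ^ n / n.factorial * Real.exp (-(s * Y ω)) =
      s ^ n / n.factorial * (Y ω ^ n * Real.exp (-s * Y ω)) := by
    intro n ω
    rw [mul_pow, neg_mul]
    ring
  -- the two signs `(-1)ⁿ`, from `(-s)ⁿ` and from differentiating `t ↦ mgf Y (-t)`, cancel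
  unfold erlangTail
  simp_rw [h1]
  rw [integral_finsetSum]
  · refine Finset.sum_congr rfl fun n _ => ?_
    rw [integral_const_mul, (eventuallyEq_mgf_neg hL hs).iteratedDeriv_eq,
      iteratedDeriv_comp_neg, iteratedDeriv_mgf hint, smul_eq_mul, ← mul_assoc,
      neg_pow s, mul_div_right_comm, mul_right_comm _ _ ((-1 : ℝ) ^ n)]
    have h2 : (-1 : ℝ) ^ n * (-1) ^ n = 1 := by rw [← mul_pow]; simp
    beta_reduce
    generalize (∫ ω, Y ω ^ n * Real.exp (-s * Y ω) ∂P) = I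
    linear_combination -(s ^ n / n.factorial * I) * h2
  · intro n _
    exact (integrable_pow_mul_exp_of_mem_interior_integrableExpSet hint n).const_mul _

end Laplace

/-! ### The success probability -/

lemma lt_ofReal_div_iff {a b S : ℝ} {I : ℝ≥0∞} (ha : 0 < a) (hb : 0 < b) (hS : 0 < S)
    (hI : I ≠ ∞) :
    ENNReal.ofReal a < ENNReal.ofReal (b * S) / I ↔ a * b⁻¹ * I.toReal < S := by
  have hbS : ENNReal.ofReal (b * S) ≠ 0 := by
    rw [Ne, ENNReal.ofReal_eq_zero, not_le]
    positivity
  rw [ENNReal.lt_div_iff_mul_lt (Or.inr ENNReal.ofReal_ne_top) (Or.inl hI)]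
  conv_lhs => rw [← ENNReal.ofReal_toReal hI, ← ENNReal.ofReal_mul ha.le]
  rw [ENNReal.ofReal_lt_ofReal_iff (by positivity), ← div_eq_mul_inv, div_mul_eq_mul_div,
    div_lt_iff₀ hb, mul_comm S]

namespace IsNetwork

/-- Conditionally on the interference the desired fading power still has its Gamma law, because
the interference depends on the points and on the remaining fading powers only. -/
lemma measure_mul_interference_lt (hnet : IsNetwork P lam x h₀ H h)
    (hm : ∀ j, Measurable (channels h₀ H h j)) (hMN : M < N) {s : ℝ} (hs : 0 ≤ s) :
    P {ω | s * (interference lam α ρ x h₀ H h ω).toReal < fading h₀ H h₀ ω} =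
      ∫⁻ ω, ENNReal.ofReal
        (erlangTail (N - M) (s * (interference lam α ρ x h₀ H h ω).toReal)) ∂P := by
  set d := meanDist lam M
  have hX : Measurable fun ω i => x i ω := measurable_pi_lambda _ hnet.poisson.measurable
  have hZ := measurable_designVectors hm
  have hT : Measurable fun ω i => fading h₀ H (h i) ω :=
    measurable_pi_lambda _ fun i => measurable_fading hm i
  have : IsProbabilityMeasure (P.map (designVectors h₀ H)) :=
    Measure.isProbabilityMeasure_map hZ.aemeasurable
  have hJ := measurable_weightedSum d α ρ
  have hE : MeasurableSet {p : (ℕ → Plane) ×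
      ((Fin M → EuclideanSpace ℂ (Fin N)) × EuclideanSpace ℂ (Fin N)) × (ℕ → ℝ) |
      s * (weightedSum d α ρ (p.1, p.2.2)).toReal < ‖residual p.2.1‖ ^ 2} := by
    refine measurableSet_lt ?_ ?_
    · exact ((hJ.comp (measurable_fst.prodMk (measurable_snd.comp measurable_snd))
        ).ennreal_toReal).const_mul s
    · exact ((measurable_residual.comp (measurable_fst.comp measurable_snd)).norm).pow_const 2
  have hEy : ∀ y : ℕ → Plane, MeasurableSet (Prod.mk y ⁻¹' {p : (ℕ → Plane) ×
      ((Fin M → EuclideanSpace ℂ (Fin N)) × EuclideanSpace ℂ (Fin N)) × (ℕ → ℝ) |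
      s * (weightedSum d α ρ (p.1, p.2.2)).toReal < ‖residual p.2.1‖ ^ 2}) :=
    fun y => measurable_prodMk_left hE
  have hg : Measurable fun p : (ℕ → Plane) × (ℕ → ℝ) =>
      ENNReal.ofReal (erlangTail (N - M) (s * (weightedSum d α ρ p).toReal)) :=
    ((continuous_erlangTail _).measurable.comp (hJ.ennreal_toReal.const_mul s)).ennreal_ofReal
  have h1 : {ω | s * (interference lam α ρ x h₀ H h ω).toReal < fading h₀ H h₀ ω} =
      (fun ω => ((fun i => x i ω), (designVectors h₀ H ω, fun i => fading h₀ H (h i) ω))) ⁻¹'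
        {p | s * (weightedSum d α ρ (p.1, p.2.2)).toReal < ‖residual p.2.1‖ ^ 2} := by
    ext ω
    rw [mem_preimage, mem_ofPred_eq, mem_ofPred_eq, fading_self_eq, interference_eq_weightedSum]
  have h2 : ∫⁻ ω, ENNReal.ofReal
        (erlangTail (N - M) (s * (interference lam α ρ x h₀ H h ω).toReal)) ∂P =
      ∫⁻ p, ENNReal.ofReal (erlangTail (N - M) (s * (weightedSum d α ρ p).toReal))
        ∂P.map (fun ω => ((fun i => x i ω), fun i => fading h₀ H (h i) ω)) := by
    rw [lintegral_map hg (hX.prodMk hT)]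
    simp_rw [interference_eq_weightedSum]
    rfl
  rw [h1, ← Measure.map_apply (hX.prodMk (hZ.prodMk hT)) hE,
    hnet.map_points_designVectors_fading hm hMN, Measure.prod_apply hE, h2,
    hnet.map_points_fading hm hMN, lintegral_prod _ hg.aemeasurable]
  refine lintegral_congr fun y => ?_
  rw [Measure.prod_apply_symm (hEy y)]
  refine lintegral_congr fun t => ?_
  exact hnet.measure_lt_normSq_residual hm hMN
    (t := s * (weightedSum d α ρ (y, t)).toReal) (mul_nonneg hs ENNReal.toReal_nonneg)

lemma successProb_eq (hnet : IsNetwork P lam x h₀ H h)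
    (hm : ∀ j, Measurable (channels h₀ H h j)) (hM : 1 ≤ M) (hMN : M < N) (hlam : 0 < lam)
    (hα : 2 < α) (hρ : 0 < ρ) (hρ₀ : 0 < ρ₀) (hR₀ : 0 < R₀) (hθ : 0 < θ) :
    successProb P lam α ρ ρ₀ R₀ θ x h₀ H h = ∫ ω, erlangTail (N - M)
      (θ * ρ₀⁻¹ * R₀ ^ α * (interference lam α ρ x h₀ H h ω).toReal) ∂P := by
  set s := θ * ρ₀⁻¹ * R₀ ^ α with hs
  have hs0 : 0 ≤ s := by positivity
  have hI := measurable_interference (lam := lam) (α := α) (ρ := ρ) hnet.poisson.measurable hm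
  have hae : {ω | ENNReal.ofReal θ < sir lam α ρ ρ₀ R₀ x h₀ H h ω} =ᵐ[P]
      {ω | s * (interference lam α ρ x h₀ H h ω).toReal < fading h₀ H h₀ ω} := by
    rw [Filter.eventuallyEq_set]
    filter_upwards [hnet.ae_interference_ne_top hm hM hMN hlam hα hρ,
      hnet.ae_linearIndependent hm hMN] with ω h1 h2
    have hS : 0 < fading h₀ H h₀ ω := by
      rw [fading_self_eq]
      have := norm_pos_iff.2 h2.2
      positivity
    -- `S₀ > 0` rules out the quotient `0 / 0`, which is `0` in `ℝ≥0∞`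
    have h3 : θ * (ρ₀ * R₀ ^ (-α))⁻¹ = s := by
      rw [Real.rpow_neg hR₀.le, mul_inv, inv_inv, ← mul_assoc]
    rw [sir, lt_ofReal_div_iff hθ (by positivity) hS h1, h3]
  rw [successProb, Measure.real, measure_congr hae, hnet.measure_mul_interference_lt hm hMN hs0,
    integral_eq_lintegral_of_nonneg_ae]
  · exact Filter.Eventually.of_forall fun ω =>
      erlangTail_nonneg _ (mul_nonneg hs0 ENNReal.toReal_nonneg)
  · exact ((continuous_erlangTail _).measurable.comp
      (hI.ennreal_toReal.const_mul s)).aestronglyMeasurable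

/-- The channel vectors of a network may be replaced by measurable ones, almost surely equal to
them. -/
lemma exists_measurable_modification {μ : Measure Ω} (hnet : IsNetwork μ lam x h₀ H h) :
    ∃ (h₀' : Ω → EuclideanSpace ℂ (Fin N)) (H' : Fin M → Ω → EuclideanSpace ℂ (Fin N))
      (h' : ℕ → Ω → EuclideanSpace ℂ (Fin N)), IsNetwork μ lam x h₀' H' h' ∧
      (∀ j, Measurable (channels h₀' H' h' j)) ∧
      ∀ᵐ ω ∂μ, h₀ ω = h₀' ω ∧ (∀ k, H k ω = H' k ω) ∧ ∀ i, h i ω = h' i ω := by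
  set C : Unit ⊕ (Fin M ⊕ ℕ) → Ω → EuclideanSpace ℂ (Fin N) :=
    fun j => (hnet.law j).aemeasurable.mk (channels h₀ H h j) with hC
  have hCeq : ∀ j, channels h₀ H h j =ᵐ[μ] C j := fun j => (hnet.law j).aemeasurable.ae_eq_mk
  have hch : channels (C (Sum.inl ())) (fun k => C (Sum.inr (Sum.inl k)))
      (fun i => C (Sum.inr (Sum.inr i))) = C := by
    funext j
    rcases j with _ | _ | _ <;> rfl
  refine ⟨C (Sum.inl ()), fun k => C (Sum.inr (Sum.inl k)), fun i => C (Sum.inr (Sum.inr i)),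
    ?_, ?_, ?_⟩
  · refine ⟨hnet.poisson, ?_, ?_, ?_⟩
    · rw [hch]
      exact fun j => (hnet.law j).congr (hCeq j).symm
    · rw [hch]
      exact hnet.indep.congr hCeq
    · rw [hch]
      refine hnet.indep_points.congr Filter.EventuallyEq.rfl ?_
      filter_upwards [ae_all_iff.2 hCeq] with ω hω
      exact funext hω
  · rw [hch]
    exact fun j => (hnet.law j).aemeasurable.measurable_mk
  · filter_upwards [ae_all_iff.2 hCeq] with ω hω
    exact ⟨hω (Sum.inl ()), fun k => hω (Sum.inr (Sum.inl k)), fun i => hω (Sum.inr (Sum.inr i))⟩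

end IsNetwork

lemma fading_congr {Ω : Type*} {N M : ℕ} {h₀ h₀' g g' : Ω → EuclideanSpace ℂ (Fin N)}
    {H H' : Fin M → Ω → EuclideanSpace ℂ (Fin N)} {ω : Ω} (h1 : h₀ ω = h₀' ω)
    (h2 : ∀ k, H k ω = H' k ω) (h3 : g ω = g' ω) :
    fading h₀ H g ω = fading h₀' H' g' ω := by
  simp only [fading, combiner, h1, h2, h3]

end PZF

open PZF

theorem theorem2 {Ω : Type*} [MeasurableSpace Ω] (P : Measure Ω) [IsProbabilityMeasure P]
    (N M : ℕ) (hM : 1 ≤ M) (hMN : M < N)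
    (lam α ρ ρ₀ R₀ θ : ℝ) (hlam : 0 < lam) (hα : 2 < α) (hρ : 0 < ρ) (hρ₀ : 0 < ρ₀)
    (hR₀ : 0 < R₀) (hθ : 0 < θ)
    (x : ℕ → Ω → Plane) (h₀ : Ω → EuclideanSpace ℂ (Fin N))
    (H : Fin M → Ω → EuclideanSpace ℂ (Fin N)) (h : ℕ → Ω → EuclideanSpace ℂ (Fin N))
    (hnet : IsNetwork P lam x h₀ H h) :
    -- `d_M` is the mean distance of the `M`-th nearest node
    (Integrable (nthDist x M) P ∧ ∫ ω, nthDist x M ω ∂P = meanDist lam M) ∧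
    -- the interference is almost surely finite and its Laplace transform has the closed form
    (∀ᵐ ω ∂P, interference lam α ρ x h₀ H h ω ≠ ∞) ∧
    (∀ s : ℝ, 0 ≤ s →
      ∫ ω, Real.exp (-(s * (interference lam α ρ x h₀ H h ω).toReal)) ∂P =
        laplaceClosedForm lam α ρ M s) ∧
    -- the closed form is smooth, and the success probability is the finite sum of its derivatives
    ContDiffOn ℝ (⊤ : ℕ∞) (laplaceClosedForm lam α ρ M) (Ioi 0) ∧
    (∀ s : ℝ, s = θ * ρ₀⁻¹ * R₀ ^ α →
      successProb P lam α ρ ρ₀ R₀ θ x h₀ H h =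
        ∑ n ∈ Finset.range (N - M),
          (-s) ^ n / n.factorial * iteratedDeriv n (laplaceClosedForm lam α ρ M) s) := by
  obtain ⟨h₀', H', h', hnet', hm, hae⟩ := hnet.exists_measurable_modification
  have hfad : ∀ᵐ ω ∂P, fading h₀ H h₀ ω = fading h₀' H' h₀' ω := by
    filter_upwards [hae] with ω hω
    exact fading_congr hω.1 hω.2.1 hω.1
  have hint : ∀ᵐ ω ∂P, interference lam α ρ x h₀ H h ω = interference lam α ρ x h₀' H' h' ω := by
    filter_upwards [hae] with ω hω
    rw [interference_eq_weightedSum, interference_eq_weightedSum]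
    congr 2
    exact funext fun i => fading_congr hω.1 hω.2.1 (hω.2.2 i)
  have hlap : ∀ s : ℝ, 0 ≤ s →
      ∫ ω, Real.exp (-(s * (interference lam α ρ x h₀' H' h' ω).toReal)) ∂P =
        laplaceClosedForm lam α ρ M s :=
    fun s hs => hnet'.integral_exp_neg_interference hm hM hMN hlam hα hρ hs
  have hY := (measurable_interference (lam := lam) (α := α) (ρ := ρ)
    hnet.poisson.measurable hm).ennreal_toReal
  have hY0 : ∀ ω, 0 ≤ (interference lam α ρ x h₀' H' h' ω).toReal :=
    fun _ => ENNReal.toReal_nonneg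
  refine ⟨hnet.poisson.integrable_nthDist_and_integral hlam hM, ?_, ?_,
    contDiffOn_laplace hlap hY hY0, ?_⟩
  · filter_upwards [hint, hnet'.ae_interference_ne_top hm hM hMN hlam hα hρ] with ω h1 h2
    rwa [h1]
  · intro s hs
    rw [← hlap s hs]
    refine integral_congr_ae ?_
    filter_upwards [hint] with ω hω
    rw [hω]
  · rintro s rfl
    have hcongr : successProb P lam α ρ ρ₀ R₀ θ x h₀ H h =
        successProb P lam α ρ ρ₀ R₀ θ x h₀' H' h' := by
      refine measureReal_congr ?_
      rw [Filter.eventuallyEq_set]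
      filter_upwards [hint, hfad] with ω h1 h2
      rw [sir, sir, h1, h2]
    rw [hcongr, hnet'.successProb_eq hm hM hMN hlam hα hρ hρ₀ hR₀ hθ,
      integral_erlangTail_eq hlap hY hY0 (by positivity)]
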